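/- Conventions. A surface is a connected Hausdorff 2-dimensional manifold without boundary. A map $M$ on a surface $S$ is a connected graph without loops, embedded in $S$ with a closed discrete set of vertices and a locally finite family of edges (so every vertex is on finitely many edges), such that every face, i.e. every connected component of the complement of the graph, is an open disc, and every edge lies in the closure of exactly two distinct faces. (The embedding is understood to be locally flat, which is automatic in dimension 2.) A flag of $M$ is an incident triple $\Phi=(v,e,F)$ of a vertex, an edge and a face. For $i\in\{0,1,2\}$ let $\Phi^i$ be the $i$-adjacent flag: it differs from $\Phi$ exactly in the vertex ($i=0$), in the edge ($i=1$; here the two edges are required to bound a common corner of $F$ at $v$), or in the face ($i=2$). Let $r_i$ be the involution $\Phi\mapsto\Phi^i$ on the set $\mathcal F(M)$ of flags, and let $\mathrm{Mon}(M)=\langle r_0,r_1,r_2\rangle\le \mathrm{Sym}(\mathcal F(M))$ be the monodromy group. The group $\mathrm{Aut}(M)$ consists of the permutations of $\mathcal F(M)$ that are induced by homeomorphisms of $S$ preserving the vertex set and the edge set. The minimal regular cover $\widetilde M$ of $M$ is the regular map with automorphism group $\mathrm{Mon}(M)$. Its surface $\widetilde S$ is obtained by taking a triangle with sides labelled $0,1,2$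 for every $g\in \mathrm{Mon}(M)$ and gluing, for all $g$ and $i$, the triangles of $g$ and $gr_i$ along their sides labelled $i$. (If for $\{i,j,k\}=\{0,1,2\}$ the product $r_jr_k$ has infinite order, the corner opposite to side $i$, at which infinitely many triangles would meet, is left out.) An end of a space $X$ is a function $E$ assigning to each compact $K\subset X$ a connected component $E(K)$ of $X\setminus K$ such that $E(K)\supset E(L)$ whenever $K\subset L$. Lemma. Let $M$ be a map on a surface $S$ such that $\mathrm{Aut}(M)$ contains a finite index subgroup isomorphic to $\mathbb Z^n$ for some $n\ge 2$, and such that $\mathrm{Aut}(M)$ has only finitely many orbits on $\mathcal F(M)$. Let $\widetilde S$ be the surface of the minimal regular cover $\widetilde M$ of $M$. Then $\widetilde S$ has exactly one end. -/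

import Mathlib

/-! ## Ends of a topological space -/

/-- An end of `X`: a function assigning to every compact set `K` a connected component of the
complement of `K`, such that larger compact sets get smaller components. -/
@[ext]
structure TopEnd (X : Type*) [TopologicalSpace X] where
  toFun : TopologicalSpace.Compacts X → Set X
  isComponent : ∀ K : TopologicalSpace.Compacts X,
    ∃ x ∈ (K : Set X)ᶜ, toFun K = connectedComponentIn (K : Set X)ᶜ x
  anti : ∀ K L : TopologicalSpace.Compacts X, K ≤ L → toFun L ⊆ toFun K

/-! ## Maps on surfaces -/

/-- The standard star with `d` legs in the open unit disc of the plane. -/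
def diskStar (d : ℕ) : Set ℂ :=
  insert 0 {z | ‖z‖ < 1 ∧ ∃ k : ℕ, k < d ∧ ∃ t : ℝ, 0 < t ∧
    z = (t : ℂ) * Complex.exp (2 * (Real.pi : ℂ) * Complex.I * ((k : ℂ) / (d : ℂ)))}

/-- The set `Γ ⊆ S` looks, near its point `x`, like the centre of a star with `d` legs. -/
def IsLocalStar {S : Type*} [TopologicalSpace S] (Γ : Set S) (x : S) (d : ℕ) : Prop :=
  ∃ φ : OpenPartialHomeomorph S ℂ, x ∈ φ.source ∧ φ x = 0 ∧
    φ.target = Metric.ball 0 1 ∧ φ '' (Γ ∩ φ.source) = diskStar d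

/-- The faces cut out by a subset `Γ` of `S`: the connected components of its complement. -/
def facesOf {S : Type*} [TopologicalSpace S] (Γ : Set S) : Set (Set S) :=
  {F | ∃ x ∈ Γᶜ, F = connectedComponentIn Γᶜ x}

/-- A map on the surface `S`: a connected, locally finite graph without loops embedded in `S`, all
of whose faces are open discs, and each of whose edges belongs to two distinct faces. Vertices are
points and edges are arcs of `S`; several edges may join the same two vertices. -/
structure SurfaceMap (S : Type*) [TopologicalSpace S] where
  vert : Set S
  edge : Set (Set S)
  /-- An edge is an arc which contains no vertex besides its two (distinct) end points. -/
  edge_arc : ∀ e ∈ edge, ∃ γ : C(unitInterval, S),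
    Function.Injective γ ∧ Set.range γ = e ∧ e ∩ vert = {γ 0, γ 1}
  /-- Distinct edges meet in common vertices only. -/
  edge_inter : ∀ e ∈ edge, ∀ e' ∈ edge, e ≠ e' → e ∩ e' ⊆ vert
  /-- Vertices form a closed discrete set. -/
  vert_locallyFinite : ∀ x : S, ∃ U ∈ nhds x, (U ∩ vert).Finite
  /-- Edges do not accumulate; in particular every vertex is on finitely many edges. -/
  edge_locallyFinite : ∀ x : S, ∃ U ∈ nhds x, {e ∈ edge | (e ∩ U).Nonempty}.Finite
  /-- The graph is connected. -/
  graph_connected : IsConnected (vert ∪ ⋃₀ edge)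
  /-- The graph is locally flat at its vertices. For a graph embedded in a surface this is
  automatic, by the Schoenflies theorem. -/
  flat_vert : ∀ x ∈ vert, ∃ d : ℕ, IsLocalStar (vert ∪ ⋃₀ edge) x d
  /-- The graph is locally flat at the interior points of its edges (likewise automatic). -/
  flat_edge : ∀ x ∈ ⋃₀ edge, x ∉ vert → IsLocalStar (vert ∪ ⋃₀ edge) x 2
  /-- Every face is an open disc. -/
  face_disc : ∀ F ∈ facesOf (vert ∪ ⋃₀ edge), Nonempty (F ≃ₜ Metric.ball (0 : ℂ) 1)
  /-- Every edge belongs to two distinct faces. -/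
  edge_two_faces : ∀ e ∈ edge, {F ∈ facesOf (vert ∪ ⋃₀ edge) | e ⊆ closure F}.ncard = 2

namespace SurfaceMap

variable {S : Type*} [TopologicalSpace S] (M : SurfaceMap S)

/-- The graph of the map, as a subset of the surface. -/
def graph : Set S := M.vert ∪ ⋃₀ M.edge

/-- The faces of the map. -/
def face : Set (Set S) := facesOf M.graph

/-- A flag: an incident triple of a vertex, an edge and a face. Since an edge has two distinct
ends and two distinct faces, such triples correspond to the triangles into which the map
divides the surface. -/
@[ext]
structure Flag where
  v : S
  e : Set S
  F : Set S
  v_mem : v ∈ M.vert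
  e_mem : e ∈ M.edge
  F_mem : F ∈ M.face
  v_e : v ∈ e
  e_F : e ⊆ closure F

/-- The edges `e` and `e'` are the two sides of a corner of the face `F` at their common
vertex `v`: arbitrarily close to `v` some connected piece of `F` touches both of them away
from `v`. -/
def SharesCorner (v : S) (e e' F : Set S) : Prop :=
  ∀ U ∈ nhds v, ∃ C : Set S, C ⊆ U ∩ F ∧ IsPreconnected C ∧
    (closure C ∩ (e \ {v})).Nonempty ∧ (closure C ∩ (e' \ {v})).Nonempty

variable {M} in
/-- `Φ` and `Ψ` are `i`-adjacent flags: they differ precisely in the vertex (`i = 0`), the edge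
(`i = 1`) or the face (`i = 2`). A face may meet the same vertex in several corners, and for
`i = 1` the two flag triangles have to lie in the same one. -/
def Adj (i : Fin 3) (Φ Ψ : M.Flag) : Prop :=
  match i with
  | 0 => Φ.v ≠ Ψ.v ∧ Φ.e = Ψ.e ∧ Φ.F = Ψ.F
  | 1 => Φ.v = Ψ.v ∧ Φ.e ≠ Ψ.e ∧ Φ.F = Ψ.F ∧ SharesCorner Φ.v Φ.e Ψ.e Φ.F
  | 2 => Φ.v = Ψ.v ∧ Φ.e = Ψ.e ∧ Φ.F ≠ Ψ.F

open Classical in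
/-- `r i` is the involution on the flags which maps every flag to its `i`-adjacent flag. (It exists
and is unique for every map; the default value is never used.) -/
noncomputable def r (i : Fin 3) : Equiv.Perm M.Flag :=
  if h : ∃ σ : Equiv.Perm M.Flag, ∀ Φ, Adj i Φ (σ Φ) then h.choose else 1

/-- The monodromy group. -/
noncomputable def Mon : Subgroup (Equiv.Perm M.Flag) := Subgroup.closure (Set.range M.r)

/-- `r i` as an element of the monodromy group. -/
noncomputable def ρ (i : Fin 3) : M.Mon := ⟨M.r i, Subgroup.subset_closure ⟨i, rfl⟩⟩

/-- A homeomorphism of the surface which preserves the vertex set and the edge set induces the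
permutation `σ` on the flags. -/
def Induces (h : S ≃ₜ S) (σ : Equiv.Perm M.Flag) : Prop :=
  h '' M.vert = M.vert ∧ (fun e : Set S => h '' e) '' M.edge = M.edge ∧
    ∀ Φ : M.Flag, (σ Φ).v = h Φ.v ∧ (σ Φ).e = h '' Φ.e ∧ (σ Φ).F = h '' Φ.F

/-- The automorphism group of the map, acting on the flags: the permutations of the flags which are
induced by homeomorphisms of the surface that preserve the graph. Thus homeomorphisms which
act in the same way on the map define the same automorphism. -/
def Aut : Subgroup (Equiv.Perm M.Flag) where
  carrier := {σ | ∃ h : S ≃ₜ S, M.Induces h σ}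
  one_mem' := ⟨Homeomorph.refl S, by simp [Induces]⟩
  mul_mem' := by
    rintro σ τ ⟨h, hv, he, hf⟩ ⟨k, kv, ke, kf⟩
    have hk : ∀ s : Set S, (k.trans h) '' s = h '' (k '' s) := fun s => by
      rw [← Set.image_comp]; rfl
    refine ⟨k.trans h, by rw [hk, kv, hv], ?_, fun Φ => ?_⟩
    · have : (fun e : Set S => (k.trans h) '' e) =
          (fun e : Set S => h '' e) ∘ (fun e : Set S => k '' e) := funext hk
      rw [this, Set.image_comp, ke, he]
    · obtain ⟨a, b, c⟩ := hf (τ Φ)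
      obtain ⟨a', b', c'⟩ := kf Φ
      rw [Equiv.Perm.mul_apply, a, b, c, a', b', c', hk, hk]
      exact ⟨rfl, rfl, rfl⟩
  inv_mem' := by
    rintro σ ⟨h, hv, he, hf⟩
    have key : ∀ s : Set S, h.symm '' (h '' s) = s := fun s => by
      rw [← Set.image_comp]; simp
    refine ⟨h.symm, ?_, ?_, fun Φ => ?_⟩
    · conv_lhs => rw [← hv]
      exact key _
    · conv_lhs => rw [← he]
      rw [← Set.image_comp]
      have : (fun e : Set S => h.symm '' e) ∘ (fun e : Set S => h '' e) = id := by
        funext e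
        exact key e
      rw [this, Set.image_id]
    · obtain ⟨a, b, c⟩ := hf (σ⁻¹ Φ)
      rw [show σ (σ⁻¹ Φ) = Φ from σ.apply_symm_apply Φ] at a b c
      rw [a, b, c, key, key]
      exact ⟨(h.symm_apply_apply _).symm, rfl, rfl⟩

/-! ## The minimal regular cover

The minimal regular cover of `M` is the regular map with automorphism group `Mon M`. Its surface
consists of one triangle for each element of `Mon M`, the triangles of `g` and `g * ρ i` being glued
along their sides labelled `i`. -/

/-- The triangle used in the construction, in barycentric coordinates. The corners labelled `0`,
`1`, `2` are a vertex, the midpoint of an edge and the centre of a face, and side `i` is opposite to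
corner `i`. The triangles meeting at corner `i` are permuted by the group generated by the other two
involutions; if it is infinite (as happens for the centres of faces with infinitely many sides),
that corner is left out, for it would not be a point of a surface. -/
def Triangle : Type :=
  {x : stdSimplex ℝ (Fin 3) // ∀ i : Fin 3, x.1 i = 1 →
    ∀ j k : Fin 3, j ≠ i → k ≠ i → IsOfFinOrder (M.ρ j * M.ρ k)}

instance : TopologicalSpace M.Triangle := inferInstanceAs (TopologicalSpace (Subtype _))

/-- The points of the triangles of `g` and `g * ρ i` with the same coordinates, on side `i`. -/
def Glue (p q : (_ : M.Mon) × M.Triangle) : Prop :=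
  ∃ i : Fin 3, p.2.1.1 i = 0 ∧ q.1 = p.1 * M.ρ i ∧ q.2 = p.2

/-- The surface of the minimal regular cover of `M`: the disjoint union of the triangles modulo the
equivalence relation generated by the gluing, with the quotient topology. -/
def CoverSurface := Quot M.Glue

instance : TopologicalSpace M.CoverSurface := inferInstanceAs (TopologicalSpace (Quot _))

end SurfaceMap

/-! The monodromy group is virtually `ℤ^m` with `m ≥ n ≥ 2`, hence one-ended, and the cover surface
has the same end as its Cayley graph.

Group theory. Homeomorphisms preserve adjacency of flags, so `Aut` commutes with `Mon`
(`Aut_Mon_comm`), and `Mon` is transitive on flags because the graph is connected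
(`exists_Mon_apply_eq`). Hence the lattice `ℤ^n` in `Aut` acts freely, with finitely many orbits,
which `Mon` permutes. An element `g` of the finite-index kernel `N` of this permutation action moves
each flag `x` by a lattice vector `c g x`. As the actions commute, `c` is multiplicative in `g`, and
it embeds `N` into a power of `ℤ^n`. So `N` is abelian, torsion-free and finitely generated, that is
`ℤ^m`. By transitivity the image of `c · x` contains a fixed power of every lattice vector, whence
`m ≥ n` (`exists_finiteIndex_mulEquiv`).

Geometry. Outside a cube, `ℤ^m` with `m ≥ 2` is connected, which gives one-endedness of the Cayley
graph (`exists_finite_forall_cayleyRel`). A compact `K` in the cover meets finitely many triangles,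
and all sufficiently distant triangles lie in one component of its complement. What remains is
compact except near missing corners. There infinitely many triangles meet, so one can turn around
the corner, avoiding `K`, until a distant triangle is reached (`exists_isCompact_compl_subset`).

That the `r i` are honest involutions, and that `Mon` is transitive, rests on the local picture at a
vertex, which polar charts make explicit. -/

open Topology Filter Complex

/-! ### Logarithmic polar coordinates at a vertex -/

/-- `P` is a parametrization in logarithmic polar coordinates of a punctured neighbourhood of the
vertex `v`, in which the graph `Γ` consists of `d` legs. The radius is a function of the
real part, and the legs are the lines on which the imaginary part is an integer. -/
structure PolarChart {S : Type*} [TopologicalSpace S] (Γ V : Set S) (v : S) (d : ℕ)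
    (P : ℂ → S) : Prop where
  cont : ContinuousOn P {w | w.re < 0}
  isOpen_image : ∀ U ⊆ {w : ℂ | w.re < 0}, IsOpen U → IsOpen (P '' U)
  nhds_mem : ∀ a ≤ 0, insert v (P '' {w | w.re < a}) ∈ 𝓝 v
  exists_subset : ∀ U ∈ 𝓝 v, ∃ a < 0, P '' {w | w.re < a} ⊆ U
  closure_subset : closure (P '' {w | w.re < -1}) ⊆ insert v (P '' {w | w.re < 0})
  eq_add : ∀ w w' : ℂ, w.re < 0 → w'.re < 0 → P w = P w' →
    ∃ m : ℤ, w' = w + ((m * d : ℤ) : ℂ) * I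
  periodic : ∀ (w : ℂ) (m : ℤ), P (w + ((m * d : ℤ) : ℂ) * I) = P w
  ne : ∀ w : ℂ, w.re < 0 → P w ≠ v
  mem_graph_iff : ∀ w : ℂ, w.re < 0 → (P w ∈ Γ ↔ ∃ k : ℤ, w.im = k)
  notMem_vert : ∀ w : ℂ, w.re < 0 → P w ∉ V

/-- The factor `2π / d` makes one unit of imaginary part a rotation from one leg to the next, and `b
≤ 0` keeps the values inside the unit disc. -/
lemma exp_mem_diskStar_iff {d : ℕ} (hd : 0 < d) {b : ℝ} (hb : b ≤ 0) {w : ℂ} (hw : w.re < 0) :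
    exp (b + (2 * Real.pi / d : ℝ) * w) ∈ diskStar d ↔ ∃ k : ℤ, w.im = k := by
  have hd' : (d : ℝ) ≠ 0 := by positivity
  have hdc : (d : ℂ) ≠ 0 := by exact_mod_cast hd'
  have hc : 0 < 2 * Real.pi / d := by positivity
  constructor
  · rintro (h | ⟨-, k, -, t, ht, h⟩)
    · exact absurd h (exp_ne_zero _)
    · rw [show (t : ℂ) = exp (Real.log t) by rw [← ofReal_exp, Real.exp_log ht], ← exp_add,
        exp_eq_exp_iff_exists_int] at h
      obtain ⟨n, h⟩ := h
      refine ⟨k + n * d, ?_⟩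
      have him := congrArg im h
      have e1 : (2 * (Real.pi : ℂ) * I * ((k : ℂ) / (d : ℂ))) =
          ((2 * Real.pi * (k / d) : ℝ) : ℂ) * I := by push_cast; ring
      have e2 : (n : ℂ) * (2 * Real.pi * I) = ((n * (2 * Real.pi) : ℝ) : ℂ) * I := by
        push_cast; ring
      rw [e1, e2] at him
      simp only [add_im, ofReal_im, im_ofReal_mul, I_im, zero_add, mul_one] at him
      push_cast
      field_simp at him
      nlinarith [Real.pi_pos]
  · rintro ⟨k, hk⟩
    -- The star numbers its legs from `0` to `d - 1`; the quotient `k / d` counts full turns.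
    refine Or.inr ⟨?_, (k % d).toNat, ?_, Real.exp (b + 2 * Real.pi / d * w.re), Real.exp_pos _, ?_⟩
    · rw [norm_exp, Real.exp_lt_one_iff]
      simp only [add_re, ofReal_re, re_ofReal_mul]
      nlinarith
    · have := Int.emod_lt_of_pos k (b := d) (by exact_mod_cast hd)
      have := Int.emod_nonneg k (b := d) (by exact_mod_cast hd.ne')
      omega
    · rw [ofReal_exp, ← exp_add, exp_eq_exp_iff_exists_int]
      refine ⟨k / d, ?_⟩
      have h1 : (((k % d).toNat : ℕ) : ℂ) = ((k % d : ℤ) : ℂ) := by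
        have := Int.emod_nonneg k (b := d) (by exact_mod_cast hd.ne')
        exact_mod_cast congrArg (Int.cast : ℤ → ℂ) (Int.toNat_of_nonneg this)
      have h2 : ((k : ℤ) : ℂ) = ((k % d : ℤ) : ℂ) + d * ((k / d : ℤ) : ℂ) := by
        exact_mod_cast congrArg (Int.cast : ℤ → ℂ) (Int.emod_add_mul_ediv k d).symm
      have h3 : w = w.re + k * I := by
        rw [← re_add_im w, hk]; simp
      rw [h1, h3]
      push_cast
      simp only [add_re, ofReal_re, mul_re, I_re, I_im, intCast_re, intCast_im]
      rw [h2]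
      field_simp
      push_cast
      ring

namespace SurfaceMap

variable {S : Type*} [TopologicalSpace S] (M : SurfaceMap S)

section Edges

variable {M}

lemma edge_isClosed [T2Space S] {e : Set S} (he : e ∈ M.edge) : IsClosed e := by
  obtain ⟨γ, -, rfl, -⟩ := M.edge_arc e he
  exact (isCompact_range γ.continuous).isClosed

lemma isClosed_sUnion_edge [T2Space S] {E : Set (Set S)} (hE : E ⊆ M.edge) :
    IsClosed (⋃₀ E) := by
  rw [Set.sUnion_eq_iUnion]
  refine LocallyFinite.isClosed_iUnion (fun x => ?_) fun e => edge_isClosed (hE e.2)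
  obtain ⟨U, hU, hf⟩ := M.edge_locallyFinite x
  refine ⟨U, hU, Set.Finite.of_finite_image (f := Subtype.val)
    (hf.subset ?_) Subtype.val_injective.injOn⟩
  rintro _ ⟨e, he, rfl⟩
  exact ⟨hE e.2, he⟩

lemma isClosed_of_subset_vert [T2Space S] {W : Set S} (hW : W ⊆ M.vert) : IsClosed W := by
  rw [← isOpen_compl_iff, isOpen_iff_mem_nhds]
  intro x hx
  obtain ⟨U, hU, hf⟩ := M.vert_locallyFinite x
  have hf' : (U ∩ W).Finite := hf.subset (Set.inter_subset_inter_right _ hW)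
  filter_upwards [hU, hf'.isClosed.isOpen_compl.mem_nhds (fun h => hx h.2)] with y h1 h2 h3
  exact h2 ⟨h1, h3⟩

lemma isClosed_graph [T2Space S] : IsClosed M.graph :=
  (isClosed_of_subset_vert subset_rfl).union (isClosed_sUnion_edge subset_rfl)

lemma edge_eq {e e' : Set S} {x : S} (he : e ∈ M.edge) (he' : e' ∈ M.edge) (hx : x ∈ e)
    (hx' : x ∈ e') (hv : x ∉ M.vert) : e = e' := by
  by_contra h
  exact hv (M.edge_inter e he e' he' h ⟨hx, hx'⟩)

lemma exists_arc {e : Set S} {v : S} (he : e ∈ M.edge) (hv : v ∈ M.vert) (hve : v ∈ e) :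
    ∃ γ : C(unitInterval, S), Function.Injective γ ∧ Set.range γ = e ∧
      e ∩ M.vert = {v, γ 1} ∧ γ 0 = v := by
  obtain ⟨γ, h1, h2, h3⟩ := M.edge_arc e he
  have h4 : v ∈ e ∩ M.vert := ⟨hve, hv⟩
  rw [h3] at h4
  rcases h4 with h4 | h4
  · exact ⟨γ, h1, h2, by rw [h3, h4], h4.symm⟩
  · refine ⟨γ.comp ⟨unitInterval.symm, unitInterval.continuous_symm⟩,
      h1.comp unitInterval.symm_bijective.injective, ?_, ?_, ?_⟩
    · rw [ContinuousMap.coe_comp, Set.range_comp]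
      simp [unitInterval.symm_bijective.surjective.range_eq, ← h2]
    · rw [h3, Set.pair_comm, h4]; simp
    · rw [h4]; simp

/-- The inverse of the flat chart is composed with `w ↦ exp (b + c * w)`, `c = 2π / d`. Legs and
sectors then become images of convex sets and a full turn becomes a translation. The constant `b` is
chosen to exclude all vertices but `v`. -/
lemma exists_polarChart [T2Space S] {v : S} {e : Set S} (hv : v ∈ M.vert) (he : e ∈ M.edge)
    (hve : v ∈ e) : ∃ (d : ℕ) (P : ℂ → S), PolarChart M.graph M.vert v d P := by
  obtain ⟨d, φ, hvs, hφv, hφt, hφ⟩ := M.flat_vert v hv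
  obtain ⟨U, hU, hUf⟩ := M.vert_locallyFinite v
  obtain ⟨W, hW, hWv⟩ : ∃ W ∈ 𝓝 v, W ∩ M.vert ⊆ {v} := by
    refine ⟨U ∩ ((U ∩ M.vert) \ {v})ᶜ, inter_mem hU
      ((hUf.subset Set.sdiff_subset).isClosed.isOpen_compl.mem_nhds (by simp)), ?_⟩
    rintro x ⟨⟨h1, h2⟩, h3⟩
    by_contra h
    exact h2 ⟨⟨h1, h3⟩, h⟩
  have hsymm0 : φ.symm 0 = v := by rw [← hφv, φ.left_inv hvs]
  have h0t : (0 : ℂ) ∈ φ.target := by rw [hφt]; simp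
  -- the chart takes small balls to small neighbourhoods
  have small : ∀ U ∈ 𝓝 v, ∃ b < (0 : ℝ), φ.symm '' Metric.ball 0 (Real.exp b) ⊆ U := by
    intro U hU
    have h1 : φ.symm ⁻¹' U ∈ 𝓝 (0 : ℂ) :=
      (φ.continuousAt_symm h0t).preimage_mem_nhds (by rwa [hsymm0])
    obtain ⟨ε, hε, hb⟩ := Metric.mem_nhds_iff.1 h1
    refine ⟨min (Real.log ε) (-1), by simp, ?_⟩
    rintro _ ⟨z, hz, rfl⟩
    refine hb (Metric.ball_subset_ball ?_ hz)
    rw [← Real.le_log_iff_exp_le hε]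
    exact min_le_left _ _
  obtain ⟨b, hb, hbW⟩ := small W hW
  -- Without legs, `v` would be an isolated point of the edge, but a nontrivial connected set has
  -- none.
  have hd : 0 < d := by
    rcases Nat.eq_zero_or_pos d with rfl | h
    · exfalso
      have hstar : diskStar 0 = {0} := by ext; simp [diskStar]
      rw [hstar] at hφ
      have hsub : ∀ x ∈ e, x ∈ φ.source → x = v := by
        intro x hx hxs
        have : φ x ∈ φ '' ((M.vert ∪ ⋃₀ M.edge) ∩ φ.source) :=
          ⟨x, ⟨Or.inr ⟨e, he, hx⟩, hxs⟩, rfl⟩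
        rw [hφ] at this
        rw [← φ.left_inv hxs, this, hsymm0]
      obtain ⟨γ, h1, rfl, -, h4⟩ := exists_arc he hv hve
      have hpre : IsPreconnected (Set.range γ) := isPreconnected_range γ.continuous
      have hnt : (Set.range γ).Nontrivial :=
        ⟨γ 0, ⟨0, rfl⟩, γ 1, ⟨1, rfl⟩, fun h => zero_ne_one (h1 h)⟩
      have := hpre.preperfect_of_nontrivial hnt v hve
      rw [accPt_iff_nhds] at this
      obtain ⟨y, ⟨hy1, hy2⟩, hy⟩ := this _ (φ.open_source.mem_nhds hvs)
      exact hy (hsub y hy2 hy1)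
    · exact h
  have hd' : (d : ℝ) ≠ 0 := by positivity
  have hdc : (d : ℂ) ≠ 0 := by exact_mod_cast hd'
  set c : ℝ := 2 * Real.pi / d with hc
  have hcpos : 0 < c := by positivity
  set ψ : ℂ → ℂ := fun w => exp (b + c * w) with hψ
  have hnorm : ∀ w, ‖ψ w‖ = Real.exp (b + c * w.re) := by
    intro w; simp [hψ, norm_exp]
  have hψ0 : ∀ w, ψ w ≠ 0 := fun w => exp_ne_zero _
  have hψt : ∀ w : ℂ, w.re < 0 → ψ w ∈ φ.target := by
    intro w hw
    rw [hφt, mem_ball_zero_iff, hnorm, Real.exp_lt_one_iff]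
    nlinarith
  have hψc : Continuous ψ := by fun_prop
  have hψo : IsOpenMap ψ := by
    refine isOpenMap_exp.comp (((Homeomorph.mulLeft₀ (c : ℂ)
      (by exact_mod_cast hcpos.ne')).trans (Homeomorph.addLeft (b : ℂ))).isOpenMap)
  have hinv : ∀ z : ℂ, z ≠ 0 → ∃ w, ψ w = z ∧ ‖z‖ = Real.exp (b + c * w.re) := by
    intro z hz
    refine ⟨(log z - b) / c, ?_⟩
    have : ψ ((log z - b) / c) = z := by
      have hcc : (c : ℂ) ≠ 0 := by exact_mod_cast hcpos.ne'
      rw [hψ]; dsimp only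
      rw [mul_div_cancel₀ _ hcc, add_sub_cancel, exp_log hz]
    exact ⟨this, by rw [← hnorm, this]⟩
  have hball : ∀ a : ℝ, a ≤ 0 → insert v ((fun w => φ.symm (ψ w)) '' {w | w.re < a}) =
      φ.symm '' Metric.ball 0 (Real.exp (b + c * a)) := by
    intro a ha
    ext x
    constructor
    · rintro (rfl | ⟨w, hw, rfl⟩)
      · exact ⟨0, by simp [Real.exp_pos], hsymm0⟩
      · refine ⟨ψ w, ?_, rfl⟩
        rw [mem_ball_zero_iff, hnorm, Real.exp_lt_exp]
        have : w.re < a := hw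
        nlinarith
    · rintro ⟨z, hz, rfl⟩
      rcases eq_or_ne z 0 with rfl | h
      · exact Or.inl hsymm0
      · obtain ⟨w, rfl, h2⟩ := hinv z h
        refine Or.inr ⟨w, ?_, rfl⟩
        rw [mem_ball_zero_iff, h2, Real.exp_lt_exp] at hz
        show w.re < a
        nlinarith
  have hPv : ∀ w : ℂ, w.re < 0 → φ.symm (ψ w) ≠ v := by
    intro w hw h
    have := φ.right_inv (hψt w hw)
    rw [h, hφv] at this
    exact hψ0 w this.symm
  refine ⟨d, fun w => φ.symm (ψ w), ?_, ?_, ?_, ?_, ?_, ?_, ?_, hPv, ?_, ?_⟩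
  · exact φ.continuousOn_symm.comp hψc.continuousOn hψt
  · intro U hU hUo
    rw [← Set.image_image]
    exact φ.symm.isOpen_image_of_subset_source (hψo U hUo)
      (by rintro _ ⟨w, hw, rfl⟩; exact hψt w (hU hw))
  · intro a ha
    rw [hball a ha]
    refine (φ.symm.isOpen_image_of_subset_source Metric.isOpen_ball ?_).mem_nhds
      ⟨0, by simp [Real.exp_pos], hsymm0⟩
    show _ ⊆ φ.target
    rw [hφt]
    refine Metric.ball_subset_ball ?_
    rw [Real.exp_le_one_iff]
    nlinarith
  · intro U hU
    obtain ⟨b', hb', h⟩ := small U hU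
    refine ⟨min ((b' - b) / c) (-1), by simp, ?_⟩
    rintro _ ⟨w, hw, rfl⟩
    refine h ⟨ψ w, ?_, rfl⟩
    rw [mem_ball_zero_iff, hnorm, Real.exp_lt_exp]
    have : w.re < (b' - b) / c := lt_of_lt_of_le hw (min_le_left _ _)
    rw [lt_div_iff₀ hcpos] at this
    linarith
  -- The bound `re w ≤ -1` corresponds to the closed disc of radius `exp (b - c)`, whose image is
  -- compact, hence closed.
  · have hsub : Metric.closedBall (0 : ℂ) (Real.exp (b - c)) ⊆ φ.target := by
      rw [hφt]
      refine Metric.closedBall_subset_ball ?_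
      rw [Real.exp_lt_one_iff]
      linarith
    have hcl : IsClosed (φ.symm '' Metric.closedBall (0 : ℂ) (Real.exp (b - c))) :=
      ((isCompact_closedBall _ _).image_of_continuousOn
        (φ.continuousOn_symm.mono hsub)).isClosed
    refine (closure_minimal ?_ hcl).trans ?_
    · rintro _ ⟨w, hw, rfl⟩
      refine ⟨ψ w, ?_, rfl⟩
      rw [mem_closedBall_zero_iff, hnorm, Real.exp_le_exp]
      have : w.re < -1 := hw
      nlinarith
    · rw [hball 0 le_rfl]
      refine Set.image_mono (Metric.closedBall_subset_ball ?_)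
      rw [Real.exp_lt_exp]
      linarith
  · intro w w' hw hw' h
    have h1 : ψ w' = ψ w := (φ.symm.injOn (hψt w hw) (hψt w' hw') h).symm
    rw [hψ] at h1
    simp only [exp_eq_exp_iff_exists_int] at h1
    obtain ⟨m, hm⟩ := h1
    refine ⟨m, ?_⟩
    have hpi : (Real.pi : ℂ) ≠ 0 := by exact_mod_cast Real.pi_ne_zero
    have h2 : (c : ℂ) = 2 * Real.pi / d := by rw [hc]; push_cast; rfl
    rw [h2] at hm
    field_simp at hm
    push_cast
    have h3 : (2 * (Real.pi : ℂ)) * (w' - (w + m * d * I)) = 0 := by linear_combination hm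
    have := (mul_eq_zero.1 h3).resolve_left (by simp [hpi])
    linear_combination this
  · intro w m
    have : ψ (w + ((m * d : ℤ) : ℂ) * I) = ψ w := by
      rw [hψ]
      simp only [exp_eq_exp_iff_exists_int]
      refine ⟨m, ?_⟩
      rw [hc]
      push_cast
      field_simp
      ring
    simp only [this]
  · intro w hw
    rw [← exp_mem_diskStar_iff hd hb.le hw, ← hc, ← hφ]
    constructor
    · intro h
      exact ⟨φ.symm (ψ w), ⟨h, φ.map_target (hψt w hw)⟩, φ.right_inv (hψt w hw)⟩
    · rintro ⟨x, ⟨hx, hxs⟩, h⟩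
      have h' : φ x = ψ w := h
      have : φ.symm (ψ w) = x := by rw [← h', φ.left_inv hxs]
      rw [this]
      exact hx
  · intro w hw h
    have h1 : φ.symm (ψ w) ∈ W := by
      refine hbW ⟨ψ w, ?_, rfl⟩
      rw [mem_ball_zero_iff, hnorm, Real.exp_lt_exp]
      nlinarith
    exact hPv w hw (hWv ⟨h1, h⟩)

end Edges

end SurfaceMap

/-! ### Legs and sectors of a polar chart -/

/-- The leg number `k` of a polar chart. -/
def polarLeg {S : Type*} (P : ℂ → S) (k : ℤ) : Set S := P '' {w | w.re < 0 ∧ w.im = k}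

/-- The sector of a polar chart between the legs `k` and `k + 1`. -/
def polarSector {S : Type*} (P : ℂ → S) (k : ℤ) : Set S :=
  P '' {w | w.re < 0 ∧ (k : ℝ) < w.im ∧ w.im < k + 1}

/-- The leg number `k` of a polar chart together with the two adjacent sectors. -/
def polarStrip {S : Type*} (P : ℂ → S) (k : ℤ) : Set S :=
  P '' {w | w.re < 0 ∧ (k : ℝ) - 1 < w.im ∧ w.im < k + 1}

namespace PolarChart

lemma convex_re_lt (a : ℝ) : Convex ℝ {w : ℂ | w.re < a} :=
  convex_halfSpace_lt reLm.isLinear _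

lemma convex_box (a b c : ℝ) : Convex ℝ {w : ℂ | w.re < a ∧ b < w.im ∧ w.im < c} := by
  refine (convex_re_lt a).inter ((convex_halfSpace_gt imLm.isLinear _).inter
    (convex_halfSpace_lt imLm.isLinear _))

lemma isOpen_box (a b c : ℝ) : IsOpen {w : ℂ | w.re < a ∧ b < w.im ∧ w.im < c} :=
  (isOpen_lt continuous_re continuous_const).inter
    ((isOpen_lt continuous_const continuous_im).inter (isOpen_lt continuous_im continuous_const))

variable {S : Type*} {P : ℂ → S}

lemma leg_nonempty (P : ℂ → S) (k : ℤ) : (polarLeg P k).Nonempty :=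
  ⟨_, ⟨-1, k⟩, by simp, rfl⟩

lemma sector_nonempty (P : ℂ → S) (k : ℤ) : (polarSector P k).Nonempty :=
  ⟨_, ⟨-1, k + 1 / 2⟩, by norm_num, rfl⟩

lemma leg_subset_strip (P : ℂ → S) (k : ℤ) : polarLeg P k ⊆ polarStrip P k := by
  rintro _ ⟨w, ⟨h1, h2⟩, rfl⟩
  exact ⟨w, ⟨h1, by linarith, by linarith⟩, rfl⟩

lemma strip_cases {k : ℤ} {x : S} (hx : x ∈ polarStrip P k) :
    x ∈ polarLeg P k ∨ x ∈ polarSector P k ∨ x ∈ polarSector P (k - 1) := by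
  obtain ⟨w, ⟨h1, h2, h3⟩, rfl⟩ := hx
  rcases lt_trichotomy w.im k with h4 | h4 | h4
  · exact Or.inr (Or.inr ⟨w, ⟨h1, by push_cast; linarith, by push_cast; linarith⟩, rfl⟩)
  · exact Or.inl ⟨w, ⟨h1, h4⟩, rfl⟩
  · exact Or.inr (Or.inl ⟨w, ⟨h1, h4, h3⟩, rfl⟩)

variable [TopologicalSpace S] {Γ V : Set S} {v : S} {d : ℕ} (h : PolarChart Γ V v d P)

include h in
lemma isPreconnected_image {C : Set ℂ} (hC : Convex ℝ C) (hs : C ⊆ {w | w.re < 0}) :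
    IsPreconnected (P '' C) :=
  hC.isPreconnected.image _ (h.cont.mono hs)

include h in
lemma isOpen_sector (k : ℤ) : IsOpen (polarSector P k) :=
  h.isOpen_image _ (fun _ hw => hw.1) (isOpen_box _ _ _)

include h in
lemma isOpen_strip (k : ℤ) : IsOpen (polarStrip P k) :=
  h.isOpen_image _ (fun _ hw => hw.1) (isOpen_box _ _ _)

include h in
lemma isPreconnected_sector (k : ℤ) : IsPreconnected (polarSector P k) :=
  h.isPreconnected_image (convex_box _ _ _) (fun _ hw => hw.1)

include h in
lemma isPreconnected_leg (k : ℤ) : IsPreconnected (polarLeg P k) :=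
  h.isPreconnected_image ((convex_re_lt 0).inter (convex_hyperplane imLm.isLinear (k : ℝ)))
    (fun _ hw => hw.1)

include h in
lemma leg_subset (k : ℤ) : polarLeg P k ⊆ Γ \ V := by
  rintro _ ⟨w, ⟨h1, h2⟩, rfl⟩
  exact ⟨(h.mem_graph_iff w h1).2 ⟨k, h2⟩, h.notMem_vert w h1⟩

include h in
lemma sector_subset (k : ℤ) : polarSector P k ⊆ Γᶜ := by
  rintro _ ⟨w, ⟨h1, h2, h3⟩, rfl⟩ hw
  obtain ⟨j, hj⟩ := (h.mem_graph_iff w h1).1 hw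
  rw [hj] at h2 h3
  have h2 : k < j := by exact_mod_cast h2
  have h3 : j < k + 1 := by exact_mod_cast h3
  omega

include h in
lemma exists_mem_leg {x : S} (hx : x ∈ P '' {w | w.re < 0}) (hΓ : x ∈ Γ) :
    ∃ k, x ∈ polarLeg P k := by
  obtain ⟨w, h1, rfl⟩ := hx
  obtain ⟨k, hk⟩ := (h.mem_graph_iff w h1).1 hΓ
  exact ⟨k, w, ⟨h1, hk⟩, rfl⟩

include h in
lemma exists_mem_sector {x : S} (hx : x ∈ P '' {w | w.re < 0}) (hΓ : x ∉ Γ) :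
    ∃ k, x ∈ polarSector P k := by
  obtain ⟨w, h1, rfl⟩ := hx
  refine ⟨⌊w.im⌋, w, ⟨h1, lt_of_le_of_ne (Int.floor_le _) fun h2 => hΓ ?_,
    Int.lt_floor_add_one _⟩, rfl⟩
  exact (h.mem_graph_iff w h1).2 ⟨_, h2.symm⟩

include h in
lemma leg_add (k m : ℤ) : polarLeg P (k + m * d) = polarLeg P k := by
  have key : ∀ k m : ℤ, polarLeg P k ⊆ polarLeg P (k + m * d) := by
    rintro k m _ ⟨w, ⟨h1, h2⟩, rfl⟩
    refine ⟨w + ((m * d : ℤ) : ℂ) * I, ⟨?_, ?_⟩, h.periodic w m⟩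
    · simpa using h1
    · simp [h2]
  refine Set.Subset.antisymm ?_ (key k m)
  have := key (k + m * d) (-m)
  rwa [show k + m * d + -m * d = k by ring] at this

include h in
lemma sector_add (k m : ℤ) : polarSector P (k + m * d) = polarSector P k := by
  have key : ∀ k m : ℤ, polarSector P k ⊆ polarSector P (k + m * d) := by
    rintro k m _ ⟨w, ⟨h1, h2, h3⟩, rfl⟩
    refine ⟨w + ((m * d : ℤ) : ℂ) * I, ⟨?_, ?_, ?_⟩, h.periodic w m⟩
    · simpa using h1
    · simpa using h2
    · simp; linarith
  refine Set.Subset.antisymm ?_ (key k m)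
  have := key (k + m * d) (-m)
  rwa [show k + m * d + -m * d = k by ring] at this

include h in
lemma leg_meet {j k : ℤ} (hjk : (polarLeg P j ∩ polarLeg P k).Nonempty) :
    ∃ m : ℤ, k = j + m * d := by
  obtain ⟨_, ⟨w, ⟨h1, h2⟩, rfl⟩, w', ⟨h1', h2'⟩, h3⟩ := hjk
  obtain ⟨m, rfl⟩ := h.eq_add w w' h1 h1' h3.symm
  refine ⟨m, ?_⟩
  simp [h2] at h2'
  exact_mod_cast h2'.symm

include h in
lemma sector_meet {j k : ℤ} (hjk : (polarSector P j ∩ polarSector P k).Nonempty) :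
    ∃ m : ℤ, k = j + m * d := by
  obtain ⟨_, ⟨w, ⟨h1, h2, h3⟩, rfl⟩, w', ⟨h1', h2', h3'⟩, h4⟩ := hjk
  obtain ⟨m, rfl⟩ := h.eq_add w w' h1 h1' h4.symm
  refine ⟨m, ?_⟩
  simp at h2' h3'
  have e1 : (k : ℝ) < j + m * d + 1 := by linarith
  have e2 : (j : ℝ) + m * d < k + 1 := by linarith
  have e1 : k < j + m * d + 1 := by exact_mod_cast e1
  have e2 : j + m * d < k + 1 := by exact_mod_cast e2
  omega

include h in
/-- A connected set in the polar chart that avoids the graph lies in any sector it meets. -/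
lemma subset_sector {C : Set S} (hC : IsPreconnected C) (hs : C ⊆ P '' {w | w.re < 0})
    (hΓ : C ⊆ Γᶜ) {k : ℤ} (hk : (C ∩ polarSector P k).Nonempty) : C ⊆ polarSector P k := by
  -- Two sectors are equal or disjoint. The others are indexed by inequality of sets, since by
  -- periodicity different numbers may name the same sector.
  refine hC.subset_left_of_subset_union (h.isOpen_sector k)
    (v := ⋃ j ∈ {j | polarSector P j ≠ polarSector P k}, polarSector P j)
    (isOpen_biUnion fun j _ => h.isOpen_sector j) ?_ ?_ hk
  · rw [Set.disjoint_iUnion₂_right]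
    intro j hj
    rw [Set.disjoint_iff_inter_eq_empty]
    by_contra hne
    obtain ⟨m, rfl⟩ := h.sector_meet (Set.nonempty_iff_ne_empty.2 hne)
    exact hj (h.sector_add k m)
  · intro x hx
    obtain ⟨j, hj⟩ := h.exists_mem_sector (hs hx) (hΓ hx)
    by_cases hjk : polarSector P j = polarSector P k
    · exact Or.inl (hjk ▸ hj)
    · exact Or.inr (Set.mem_biUnion hjk hj)

include h in
lemma mem_closure_leg (k : ℤ) : v ∈ closure (polarLeg P k) := by
  rw [mem_closure_iff_nhds]
  intro U hU
  obtain ⟨a, ha, haU⟩ := h.exists_subset U hU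
  refine ⟨P ⟨a - 1, k⟩, haU ⟨_, ?_, rfl⟩, ⟨_, ⟨?_, rfl⟩, rfl⟩⟩
  · simp
  · show a - 1 < 0
    linarith

end PolarChart

/-! ### Edges, faces and corners seen in a polar chart -/

namespace SurfaceMap

variable {S : Type*} [TopologicalSpace S] {M : SurfaceMap S} {v : S} {d : ℕ}
  {P : ℂ → S}

lemma face_subset {F : Set S} (hF : F ∈ M.face) : F ⊆ M.graphᶜ := by
  obtain ⟨x, -, rfl⟩ := hF
  exact connectedComponentIn_subset _ _

lemma face_eq {F F' : Set S} (hF : F ∈ M.face) (hF' : F' ∈ M.face) (h : (F ∩ F').Nonempty) :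
    F = F' := by
  obtain ⟨y, h1, h2⟩ := h
  obtain ⟨x, -, rfl⟩ := hF
  obtain ⟨x', -, rfl⟩ := hF'
  rw [connectedComponentIn_eq h1, connectedComponentIn_eq h2]

lemma subset_face {F C : Set S} (hF : F ∈ M.face) (hC : IsPreconnected C) (hΓ : C ⊆ M.graphᶜ)
    (h : (C ∩ F).Nonempty) : C ⊆ F := by
  obtain ⟨y, h1, h2⟩ := h
  obtain ⟨x, -, rfl⟩ := hF
  rw [connectedComponentIn_eq h2]
  exact hC.subset_connectedComponentIn h1 hΓ

lemma edge_eq_of_leg (h : PolarChart M.graph M.vert v d P) {k : ℤ} {e e' : Set S}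
    (he : e ∈ M.edge) (he' : e' ∈ M.edge) (hk : polarLeg P k ⊆ e) (hk' : polarLeg P k ⊆ e') :
    e = e' := by
  obtain ⟨x, hx⟩ := PolarChart.leg_nonempty P k
  exact edge_eq he he' (hk hx) (hk' hx) (h.leg_subset k hx).2

lemma exists_sector_subset (h : PolarChart M.graph M.vert v d P) (k : ℤ) :
    ∃ F ∈ M.face, polarSector P k ⊆ F := by
  obtain ⟨x, hx⟩ := PolarChart.sector_nonempty P k
  exact ⟨_, ⟨x, h.sector_subset k hx, rfl⟩,
    (h.isPreconnected_sector k).subset_connectedComponentIn hx (h.sector_subset k)⟩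

lemma sharesCorner_symm {v : S} {e e' F : Set S} (h : SharesCorner v e e' F) :
    SharesCorner v e' e F := by
  intro U hU
  obtain ⟨C, h1, h2, h3, h4⟩ := h U hU
  exact ⟨C, h1, h2, h4, h3⟩

/-- The faces at an edge are those of the two sectors on either side of its leg. -/
lemma faces_of_edge (h : PolarChart M.graph M.vert v d P) {k : ℤ} {e : Set S}
    (he : e ∈ M.edge) (hk : polarLeg P k ⊆ e) :
    ∃ A ∈ M.face, ∃ B ∈ M.face, polarSector P k ⊆ A ∧ polarSector P (k - 1) ⊆ B ∧ A ≠ B ∧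
      e ⊆ closure A ∧ e ⊆ closure B ∧ ∀ F ∈ M.face, e ⊆ closure F → F = A ∨ F = B := by
  obtain ⟨A, hA, hkA⟩ := exists_sector_subset h k
  obtain ⟨B, hB, hkB⟩ := exists_sector_subset h (k - 1)
  have key : ∀ F ∈ M.face, e ⊆ closure F → F = A ∨ F = B := by
    intro F hF heF
    obtain ⟨x, hx⟩ := PolarChart.leg_nonempty P k
    obtain ⟨y, hy, hyF⟩ := mem_closure_iff.1 (heF (hk hx)) _ (h.isOpen_strip k)
      (PolarChart.leg_subset_strip P k hx)
    rcases PolarChart.strip_cases hy with h1 | h1 | h1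
    · exact absurd (h.leg_subset k h1).1 (face_subset hF hyF)
    · exact Or.inl (face_eq hF hA ⟨y, hyF, hkA h1⟩)
    · exact Or.inr (face_eq hF hB ⟨y, hyF, hkB h1⟩)
  -- The two distinct faces at `e` both occur among `A` and `B`, which forces `A ≠ B`.
  obtain ⟨F₁, F₂, hne, hset⟩ := Set.ncard_eq_two.1 (M.edge_two_faces e he)
  have h1 : F₁ ∈ {F ∈ facesOf (M.vert ∪ ⋃₀ M.edge) | e ⊆ closure F} := by
    rw [hset]; simp
  have h2 : F₂ ∈ {F ∈ facesOf (M.vert ∪ ⋃₀ M.edge) | e ⊆ closure F} := by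
    rw [hset]; simp
  rcases key F₁ h1.1 h1.2 with r1 | r1 <;> rcases key F₂ h2.1 h2.2 with r2 | r2
  · exact absurd (r1.trans r2.symm) hne
  · subst r1 r2
    exact ⟨F₁, hA, F₂, hB, hkA, hkB, hne, h1.2, h2.2, key⟩
  · subst r1 r2
    exact ⟨F₂, hA, F₁, hB, hkA, hkB, hne.symm, h2.2, h1.2, key⟩
  · exact absurd (r1.trans r2.symm) hne

/-- The part of the sector close to `v` is connected, and its closure contains points of both
bounding legs. -/
lemma sharesCorner_of_sector (h : PolarChart M.graph M.vert v d P)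
    {k : ℤ} {e e' F : Set S} (hk : polarLeg P k ⊆ e)
    (hk' : polarLeg P (k + 1) ⊆ e') (hF : polarSector P k ⊆ F) : SharesCorner v e e' F := by
  intro U hU
  obtain ⟨a, ha, haU⟩ := h.exists_subset U hU
  have hsub : {w : ℂ | w.re < a ∧ (k : ℝ) < w.im ∧ w.im < k + 1} ⊆ {w | w.re < 0} :=
    fun w hw => hw.1.trans ha
  have hcl : ∀ t : ℝ, (k : ℝ) ≤ t → t ≤ k + 1 → P ⟨a - 1, t⟩ ∈
      closure (P '' {w : ℂ | w.re < a ∧ (k : ℝ) < w.im ∧ w.im < k + 1}) := by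
    intro t h1 h2
    have hneg : (⟨a - 1, t⟩ : ℂ) ∈ {w : ℂ | w.re < 0} := by
      show a - 1 < 0
      linarith
    refine ((h.cont _ hneg).mono hsub).mem_closure_image ?_
    have hc : Continuous fun s : ℝ => (⟨a - 1, s⟩ : ℂ) := by
      have : (fun s : ℝ => (⟨a - 1, s⟩ : ℂ)) = fun s : ℝ => ((a - 1 : ℝ) : ℂ) + s * I := by
        funext s; apply Complex.ext <;> simp
      rw [this]; fun_prop
    have ht : t ∈ closure (Set.Ioo (k : ℝ) (k + 1)) := by
      rw [closure_Ioo (by linarith)]; exact ⟨h1, h2⟩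
    refine closure_mono ?_ (image_closure_subset_closure_image hc ⟨t, ht, rfl⟩)
    rintro _ ⟨s, hs, rfl⟩
    exact ⟨by show a - 1 < a; linarith, hs.1, hs.2⟩
  refine ⟨_, Set.subset_inter ?_ ?_, h.isPreconnected_image (PolarChart.convex_box _ _ _) hsub,
    ⟨P ⟨a - 1, k⟩, hcl k le_rfl (by linarith), hk ⟨_, ⟨?_, rfl⟩, rfl⟩, ?_⟩,
    ⟨P ⟨a - 1, k + 1⟩, hcl (k + 1) (by linarith) le_rfl, hk' ⟨_, ⟨?_, ?_⟩, rfl⟩, ?_⟩⟩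
  · exact (Set.image_mono fun w hw => hw.1).trans haU
  · exact fun _ ⟨w, hw, hwx⟩ => hF ⟨w, ⟨hsub hw, hw.2⟩, hwx⟩
  · show a - 1 < 0
    linarith
  · exact h.ne _ (by show a - 1 < 0; linarith)
  · show a - 1 < 0
    linarith
  · push_cast; rfl
  · exact h.ne _ (by show a - 1 < 0; linarith)

variable [T2Space S]

/-- A leg is connected and contains no vertex. One edge and the union of all others are closed sets
that cover it and do not meet on it. -/
lemma exists_leg_subset (h : PolarChart M.graph M.vert v d P) (k : ℤ) :
    ∃ e ∈ M.edge, polarLeg P k ⊆ e := by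
  obtain ⟨x, hx⟩ := PolarChart.leg_nonempty P k
  have hmem : ∀ y ∈ polarLeg P k, y ∈ ⋃₀ M.edge ∧ y ∉ M.vert := fun y hy =>
    ⟨(h.leg_subset k hy).1.resolve_left (h.leg_subset k hy).2, (h.leg_subset k hy).2⟩
  obtain ⟨⟨e, he, hxe⟩, hxv⟩ := hmem x hx
  refine ⟨e, he, ?_⟩
  have hpre := isPreconnected_closed_iff.1 (h.isPreconnected_leg k) e
    (⋃₀ {e' ∈ M.edge | e' ≠ e}) (edge_isClosed he) (isClosed_sUnion_edge (fun _ h => h.1)) ?_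
    ⟨x, hx, hxe⟩
  · intro y hy
    obtain ⟨⟨e', he', hye'⟩, hyv⟩ := hmem y hy
    by_cases hee : e' = e
    · exact hee ▸ hye'
    · obtain ⟨z, hz, hze, e'', ⟨he'', hne⟩, hze''⟩ := hpre ⟨y, hy, e', ⟨he', hee⟩, hye'⟩
      exact absurd (edge_eq he'' he hze'' hze (hmem z hz).2) hne
  · intro y hy
    obtain ⟨⟨e', he', hye'⟩, hyv⟩ := hmem y hy
    by_cases hee : e' = e
    · exact Or.inl (hee ▸ hye')
    · exact Or.inr ⟨e', ⟨he', hee⟩, hye'⟩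

lemma mem_of_leg_subset (h : PolarChart M.graph M.vert v d P) {k : ℤ} {e : Set S}
    (he : e ∈ M.edge) (hk : polarLeg P k ⊆ e) : v ∈ e :=
  closure_minimal hk (edge_isClosed he) (h.mem_closure_leg k)

/-- An edge at the vertex `v` contains exactly one leg of the polar chart. -/
lemma exists_leg_of_edge (h : PolarChart M.graph M.vert v d P) {e : Set S} (he : e ∈ M.edge)
    (hv : v ∈ M.vert) (hve : v ∈ e) :
    ∃ k, polarLeg P k ⊆ e ∧ ∀ j, polarLeg P j ⊆ e → ∃ m : ℤ, j = k + m * d := by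
  obtain ⟨γ, hinj, hrange, -, hγ0⟩ := exists_arc he hv hve
  have hN : γ ⁻¹' insert v (P '' {w | w.re < 0}) ∈ 𝓝 (0 : unitInterval) :=
    γ.continuous.continuousAt.preimage_mem_nhds (by rw [hγ0]; exact h.nhds_mem 0 le_rfl)
  obtain ⟨δ, hδ, hδs⟩ : ∃ δ > (0 : unitInterval), ∀ s < δ, γ s ∈ insert v (P '' {w | w.re < 0}) := by
    obtain ⟨u, hu, hus⟩ := exists_Ico_subset_of_mem_nhds hN ⟨1, zero_lt_one⟩
    exact ⟨u, hu, fun s hs => hus ⟨s.2.1, hs⟩⟩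
  have hin : ∀ s, 0 < s → s < δ → γ s ∈ P '' {w | w.re < 0} ∧ γ s ∈ M.graph := by
    intro s h0 h1
    refine ⟨(hδs s h1).resolve_left fun h2 => h0.ne' (hinj (h2.trans hγ0.symm)), ?_⟩
    exact Or.inr ⟨e, he, hrange ▸ Set.mem_range_self s⟩
  obtain ⟨s₀, hs0, hs1⟩ := exists_between hδ
  obtain ⟨k, hk⟩ := h.exists_mem_leg (hin s₀ hs0 hs1).1 (hin s₀ hs0 hs1).2
  have hke : polarLeg P k ⊆ e := by
    obtain ⟨e', he', hke'⟩ := exists_leg_subset h k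
    have : e' = e := edge_eq he' he (hke' hk) (hrange ▸ Set.mem_range_self s₀)
      (h.leg_subset k hk).2
    exact this ▸ hke'
  refine ⟨k, hke, fun j hj => ?_⟩
  have hpre : IsPreconnected (γ '' Set.Ioo 0 δ) :=
    isPreconnected_Ioo.image _ γ.continuous.continuousOn
  -- on an initial segment the edge stays in one leg
  have hmem : ∀ x ∈ γ '' Set.Ioo 0 δ, ∀ j, x ∈ polarStrip P j → x ∈ polarLeg P j := by
    rintro _ ⟨s, hs, rfl⟩ j hj
    rcases PolarChart.strip_cases hj with h1 | h1 | h1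
    · exact h1
    · exact absurd (hin s hs.1 hs.2).2 (h.sector_subset _ h1)
    · exact absurd (hin s hs.1 hs.2).2 (h.sector_subset _ h1)
  have hsub : γ '' Set.Ioo 0 δ ⊆ polarLeg P k := by
    have hcov : ∀ x ∈ γ '' Set.Ioo 0 δ, x ∉ polarLeg P k →
        x ∈ ⋃ j ∈ {j | polarLeg P j ≠ polarLeg P k}, polarStrip P j := by
      rintro x hx hxk
      obtain ⟨s, hs, rfl⟩ := hx
      obtain ⟨j, hj⟩ := h.exists_mem_leg (hin s hs.1 hs.2).1 (hin s hs.1 hs.2).2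
      exact Set.mem_biUnion (x := j) (fun h3 => hxk (h3 ▸ hj))
        (PolarChart.leg_subset_strip P j hj)
    intro x hx
    by_contra hxk
    obtain ⟨y, hy, hyk, hy'⟩ := hpre (polarStrip P k) _ (h.isOpen_strip k)
      (isOpen_biUnion fun j _ => h.isOpen_strip j)
      (fun y hy => by
        by_cases hyk : y ∈ polarLeg P k
        · exact Or.inl (PolarChart.leg_subset_strip P k hyk)
        · exact Or.inr (hcov y hy hyk))
      ⟨γ s₀, ⟨s₀, ⟨hs0, hs1⟩, rfl⟩, PolarChart.leg_subset_strip P k hk⟩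
      ⟨x, hx, hcov x hx hxk⟩
    obtain ⟨j, hj, hyj⟩ := Set.mem_iUnion₂.1 hy'
    obtain ⟨m, rfl⟩ := h.leg_meet ⟨y, hmem y hy k hyk, hmem y hy j hyj⟩
    exact hj (h.leg_add k m)
  -- The rest of the arc is compact and misses `v`, so points of leg `j` close to `v` belong to the
  -- initial segment, which lies in leg `k`.
  have hcl : IsClosed (γ '' Set.Ici δ) := (isClosed_Ici.isCompact.image γ.continuous).isClosed
  have hvcl : v ∉ γ '' Set.Ici δ := by
    rintro ⟨s, hs, hsv⟩
    have : s = 0 := hinj (hsv.trans hγ0.symm)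
    exact absurd (this ▸ hs : δ ≤ 0) (not_le.2 hδ)
  obtain ⟨a, ha, haU⟩ := h.exists_subset _ (hcl.isOpen_compl.mem_nhds hvcl)
  have hx : P ⟨a - 1, j⟩ ∈ polarLeg P j := ⟨_, ⟨show a - 1 < 0 by linarith, rfl⟩, rfl⟩
  obtain ⟨s, hs⟩ : P ⟨a - 1, j⟩ ∈ Set.range γ := hrange ▸ hj hx
  have hs' : s < δ := by
    by_contra hle
    exact haU ⟨_, by simp, rfl⟩ ⟨s, not_lt.1 hle, hs⟩
  have hs0 : 0 < s := by
    refine lt_of_le_of_ne s.2.1 ?_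
    intro h0
    have : s = 0 := h0.symm
    rw [this, hγ0] at hs
    exact (h.leg_subset j hx).2 (hs ▸ hv)
  exact h.leg_meet ⟨_, hsub ⟨s, ⟨hs0, hs'⟩, hs⟩, hx⟩

/-- Neighbouring legs belong to different edges. -/
lemma edge_ne_of_leg_succ (h : PolarChart M.graph M.vert v d P) (hv : v ∈ M.vert) {k : ℤ}
    {e e' : Set S} (he : e ∈ M.edge) (hk : polarLeg P k ⊆ e) (hk' : polarLeg P (k + 1) ⊆ e') :
    e ≠ e' := by
  rintro rfl
  obtain ⟨j, -, hj⟩ := exists_leg_of_edge h he hv (mem_of_leg_subset h he hk)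
  obtain ⟨m, hm⟩ := hj k hk
  obtain ⟨m', hm'⟩ := hj (k + 1) hk'
  obtain ⟨A, hA, B, hB, hkA, hkB, hne, -⟩ := faces_of_edge h he hk
  -- A common edge forces a period of one leg, so the sectors on both sides of the edge coincide,
  -- although they lie in different faces.
  have h1 : (m' - m) * (d : ℤ) = 1 := by linarith
  have : polarSector P k = polarSector P (k - 1) := by
    rw [← h.sector_add (k - 1) (m' - m), h1, sub_add_cancel]
  obtain ⟨x, hx⟩ := PolarChart.sector_nonempty P k
  exact hne (face_eq hA hB ⟨x, hkA hx, hkB (this ▸ hx)⟩)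

/-- Two distinct edges sharing a corner of `F` contain neighbouring legs, between which there is
a sector in `F`. -/
lemma exists_sector_of_sharesCorner (h : PolarChart M.graph M.vert v d P)
    {e e' F : Set S} (he : e ∈ M.edge) (he' : e' ∈ M.edge) (hF : F ∈ M.face)
    (hne : e ≠ e') (hc : SharesCorner v e e' F) :
    ∃ k, polarSector P k ⊆ F ∧ ((polarLeg P k ⊆ e ∧ polarLeg P (k + 1) ⊆ e') ∨
      (polarLeg P (k + 1) ⊆ e ∧ polarLeg P k ⊆ e')) := by
  -- Radius `-1` instead of `0` keeps the closure of `C` inside the chart.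
  obtain ⟨C, hCU, hC, ⟨x, hxC, hxe, hxv⟩, y, hyC, hye, hyv⟩ := hc _ (h.nhds_mem (-1) (by norm_num))
  have hCF : C ⊆ F := fun z hz => (hCU hz).2
  have hCΓ : C ⊆ M.graphᶜ := hCF.trans (face_subset hF)
  have hvΓ : v ∈ M.graph := by
    have : IsClosed M.graph := isClosed_graph
    refine this.closure_subset_iff.2 ?_ (h.mem_closure_leg 0)
    exact fun z hz => (h.leg_subset 0 hz).1
  have hCP1 : C ⊆ P '' {w | w.re < -1} := fun z hz =>
    (hCU hz).1.resolve_left fun h1 => hCΓ hz (h1 ▸ hvΓ)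
  have hCP : C ⊆ P '' {w | w.re < 0} :=
    hCP1.trans (Set.image_mono fun w (hw : w.re < -1) => show w.re < 0 by linarith)
  have hcl := (closure_mono hCP1).trans h.closure_subset
  -- a point of an edge in the closure of `C` lies on a leg of the edge, next to `C`
  have key : ∀ e ∈ M.edge, ∀ x ∈ closure C, x ∈ e → x ∉ ({v} : Set S) →
      ∃ a, polarLeg P a ⊆ e ∧ (C ⊆ polarSector P a ∨ C ⊆ polarSector P (a - 1)) := by
    intro e he x hxC hxe hxv
    obtain ⟨a, hxa⟩ := h.exists_mem_leg ((hcl hxC).resolve_left hxv) (Or.inr ⟨e, he, hxe⟩)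
    obtain ⟨e₁, he₁, hae₁⟩ := exists_leg_subset h a
    have : e₁ = e := edge_eq he₁ he (hae₁ hxa) hxe (h.leg_subset a hxa).2
    refine ⟨a, this ▸ hae₁, ?_⟩
    obtain ⟨z, hz, hzC⟩ := mem_closure_iff.1 hxC _ (h.isOpen_strip a)
      (PolarChart.leg_subset_strip P a hxa)
    rcases PolarChart.strip_cases hz with h1 | h1 | h1
    · exact absurd (h.leg_subset a h1).1 (hCΓ hzC)
    · exact Or.inl (h.subset_sector hC hCP hCΓ ⟨z, hzC, h1⟩)
    · exact Or.inr (h.subset_sector hC hCP hCΓ ⟨z, hzC, h1⟩)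
  obtain ⟨z, hz⟩ : C.Nonempty := closure_nonempty_iff.1 ⟨x, hxC⟩
  have hsec : ∀ a, C ⊆ polarSector P a → polarSector P a ⊆ F := fun a ha =>
    subset_face hF (h.isPreconnected_sector a) (h.sector_subset a) ⟨z, ha hz, hCF hz⟩
  obtain ⟨a, hae, ha⟩ := key e he x hxC hxe hxv
  obtain ⟨b, hbe, hb⟩ := key e' he' y hyC hye hyv
  -- If `C` lies on the same side of both legs, the legs agree and so do the edges; on opposite
  -- sides the legs are neighbours.
  rcases ha with ha | ha <;> rcases hb with hb | hb <;>
    obtain ⟨m, hm⟩ := h.sector_meet ⟨z, ha hz, hb hz⟩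
  · subst hm
    rw [h.leg_add] at hbe
    exact absurd (edge_eq_of_leg h he he' hae hbe) hne
  · refine ⟨a, hsec a ha, Or.inl ⟨hae, ?_⟩⟩
    have : b = a + 1 + m * d := by linarith
    rwa [this, h.leg_add] at hbe
  · refine ⟨a - 1, hsec _ ha, Or.inr ⟨by rwa [sub_add_cancel], ?_⟩⟩
    rwa [hm, h.leg_add] at hbe
  · have : b = a + m * d := by linarith
    rw [this, h.leg_add] at hbe
    exact absurd (edge_eq_of_leg h he he' hae hbe) hne

end SurfaceMap

/-! ### Adjacent flags, the involutions and transitivity -/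

namespace SurfaceMap

variable {S : Type*} [TopologicalSpace S] {M : SurfaceMap S}

lemma exists_polarChart_of_flag [T2Space S] (Φ : M.Flag) :
    ∃ (d : ℕ) (P : ℂ → S), PolarChart M.graph M.vert Φ.v d P :=
  exists_polarChart Φ.v_mem Φ.e_mem Φ.v_e

lemma eq_or_eq_of_mem_edge {e : Set S} (he : e ∈ M.edge) :
    ∃ a b, a ≠ b ∧ a ∈ e ∧ b ∈ e ∧ a ∈ M.vert ∧ b ∈ M.vert ∧
      ∀ x ∈ e, x ∈ M.vert → x = a ∨ x = b := by
  obtain ⟨γ, h1, h2, h3⟩ := M.edge_arc e he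
  have ha : γ 0 ∈ e ∩ M.vert := by rw [h3]; simp
  have hb : γ 1 ∈ e ∩ M.vert := by rw [h3]; simp
  refine ⟨γ 0, γ 1, fun h => zero_ne_one (h1 h), ha.1, hb.1, ha.2, hb.2, fun x hx hv => ?_⟩
  have : x ∈ e ∩ M.vert := ⟨hx, hv⟩
  rwa [h3] at this

lemma exists_faces_of_edge {e : Set S} (he : e ∈ M.edge) :
    ∃ A B, A ≠ B ∧ A ∈ M.face ∧ B ∈ M.face ∧ e ⊆ closure A ∧ e ⊆ closure B ∧
      ∀ F ∈ M.face, e ⊆ closure F → F = A ∨ F = B := by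
  obtain ⟨A, B, hne, hset⟩ := Set.ncard_eq_two.1 (M.edge_two_faces e he)
  have key : ∀ F, (F ∈ M.face ∧ e ⊆ closure F) ↔ F = A ∨ F = B := fun F =>
    show F ∈ {F ∈ facesOf (M.vert ∪ ⋃₀ M.edge) | e ⊆ closure F} ↔ _ by rw [hset]; simp
  have hA := (key A).2 (Or.inl rfl)
  have hB := (key B).2 (Or.inr rfl)
  exact ⟨A, B, hne, hA.1, hB.1, hA.2, hB.2, fun F h1 h2 => (key F).1 ⟨h1, h2⟩⟩

lemma adj_symm {i : Fin 3} {Φ Ψ : M.Flag} (h : Adj i Φ Ψ) : Adj i Ψ Φ := by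
  fin_cases i
  · exact ⟨h.1.symm, h.2.1.symm, h.2.2.symm⟩
  · obtain ⟨h1, h2, h3, h4⟩ : Φ.v = Ψ.v ∧ Φ.e ≠ Ψ.e ∧ Φ.F = Ψ.F ∧
      SharesCorner Φ.v Φ.e Ψ.e Φ.F := h
    refine ⟨h1.symm, h2.symm, h3.symm, ?_⟩
    rw [← h1, ← h3]
    exact sharesCorner_symm h4
  · exact ⟨h.1.symm, h.2.1.symm, h.2.2.symm⟩

lemma sharesCorner_image (h : S ≃ₜ S) {v : S} {e e' F : Set S} (hc : SharesCorner v e e' F) :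
    SharesCorner (h v) (h '' e) (h '' e') (h '' F) := by
  intro U hU
  obtain ⟨C, hC, h1, ⟨x, hx, hxe, hxv⟩, y, hy, hye, hyv⟩ :=
    hc (h ⁻¹' U) (h.continuous.continuousAt.preimage_mem_nhds hU)
  refine ⟨h '' C, ?_, h1.image _ h.continuous.continuousOn, ?_, ?_⟩
  · rintro _ ⟨z, hz, rfl⟩
    exact ⟨(hC hz).1, z, (hC hz).2, rfl⟩
  · rw [← h.image_closure]
    exact ⟨h x, ⟨x, hx, rfl⟩, ⟨x, hxe, rfl⟩, fun hh => hxv (h.injective hh)⟩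
  · rw [← h.image_closure]
    exact ⟨h y, ⟨y, hy, rfl⟩, ⟨y, hye, rfl⟩, fun hh => hyv (h.injective hh)⟩

variable [T2Space S]

/-- An edge has two ends and two faces, which settles `i = 0` and `i = 2`. For `i = 1`, exactly one
of the two sectors at the leg of the edge lies in the face, and its other leg determines the new
edge. -/
lemma adj_unique {i : Fin 3} {Φ Ψ Ψ' : M.Flag} (h : Adj i Φ Ψ) (h' : Adj i Φ Ψ') : Ψ = Ψ' := by
  fin_cases i
  · obtain ⟨h1, h2, h3⟩ : Φ.v ≠ Ψ.v ∧ Φ.e = Ψ.e ∧ Φ.F = Ψ.F := h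
    obtain ⟨h1', h2', h3'⟩ : Φ.v ≠ Ψ'.v ∧ Φ.e = Ψ'.e ∧ Φ.F = Ψ'.F := h'
    refine Flag.ext ?_ (h2.symm.trans h2') (h3.symm.trans h3')
    obtain ⟨a, b, -, -, -, -, -, hab⟩ := eq_or_eq_of_mem_edge Φ.e_mem
    have e0 := hab Φ.v Φ.v_e Φ.v_mem
    have e1 := hab Ψ.v (h2 ▸ Ψ.v_e) Ψ.v_mem
    have e2 := hab Ψ'.v (h2' ▸ Ψ'.v_e) Ψ'.v_mem
    grind
  · obtain ⟨h1, h2, h3, h4⟩ : Φ.v = Ψ.v ∧ Φ.e ≠ Ψ.e ∧ Φ.F = Ψ.F ∧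
      SharesCorner Φ.v Φ.e Ψ.e Φ.F := h
    obtain ⟨h1', h2', h3', h4'⟩ : Φ.v = Ψ'.v ∧ Φ.e ≠ Ψ'.e ∧ Φ.F = Ψ'.F ∧
      SharesCorner Φ.v Φ.e Ψ'.e Φ.F := h'
    refine Flag.ext (h1.symm.trans h1') ?_ (h3.symm.trans h3')
    obtain ⟨d, P, hP⟩ := exists_polarChart_of_flag Φ
    obtain ⟨k, hk, hk'⟩ := exists_leg_of_edge hP Φ.e_mem Φ.v_mem Φ.v_e
    obtain ⟨A, hA, B, hB, hkA, hkB, hAB, -⟩ := faces_of_edge hP Φ.e_mem hk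
    have key : ∀ e' ∈ M.edge, Φ.e ≠ e' → SharesCorner Φ.v Φ.e e' Φ.F →
        (Φ.F = A ∧ polarLeg P (k + 1) ⊆ e') ∨ (Φ.F = B ∧ polarLeg P (k - 1) ⊆ e') := by
      intro e' he' hne hc
      obtain ⟨j, hj, ⟨hj1, hj2⟩ | ⟨hj1, hj2⟩⟩ :=
        exists_sector_of_sharesCorner hP Φ.e_mem he' Φ.F_mem hne hc
      · obtain ⟨m, rfl⟩ := hk' j hj1
        rw [hP.sector_add] at hj
        rw [show k + m * d + 1 = k + 1 + m * d by ring, hP.leg_add] at hj2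
        obtain ⟨x, hx⟩ := PolarChart.sector_nonempty P k
        exact Or.inl ⟨face_eq Φ.F_mem hA ⟨x, hj hx, hkA hx⟩, hj2⟩
      · obtain ⟨m, hm⟩ := hk' (j + 1) hj1
        have : j = k - 1 + m * d := by linarith
        rw [this, hP.sector_add] at hj
        rw [this, hP.leg_add] at hj2
        obtain ⟨x, hx⟩ := PolarChart.sector_nonempty P (k - 1)
        exact Or.inr ⟨face_eq Φ.F_mem hB ⟨x, hj hx, hkB hx⟩, hj2⟩
    rcases key _ Ψ.e_mem h2 h4 with ⟨f1, l1⟩ | ⟨f1, l1⟩ <;>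
      rcases key _ Ψ'.e_mem h2' h4' with ⟨f2, l2⟩ | ⟨f2, l2⟩
    · exact edge_eq_of_leg hP Ψ.e_mem Ψ'.e_mem l1 l2
    · exact absurd (f1.symm.trans f2) hAB
    · exact absurd (f2.symm.trans f1) hAB
    · exact edge_eq_of_leg hP Ψ.e_mem Ψ'.e_mem l1 l2
  · obtain ⟨h1, h2, h3⟩ : Φ.v = Ψ.v ∧ Φ.e = Ψ.e ∧ Φ.F ≠ Ψ.F := h
    obtain ⟨h1', h2', h3'⟩ : Φ.v = Ψ'.v ∧ Φ.e = Ψ'.e ∧ Φ.F ≠ Ψ'.F := h'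
    refine Flag.ext (h1.symm.trans h1') (h2.symm.trans h2') ?_
    obtain ⟨A, B, -, -, -, -, -, hAB⟩ := exists_faces_of_edge Φ.e_mem
    have e0 := hAB Φ.F Φ.F_mem Φ.e_F
    have e1 := hAB Ψ.F Ψ.F_mem (h2 ▸ Ψ.e_F)
    have e2 := hAB Ψ'.F Ψ'.F_mem (h2' ▸ Ψ'.e_F)
    grind

/-- Every sector of a polar chart at a vertex yields two flags, one for each bounding leg, that
are `1`-adjacent. -/
lemma exists_adj_of_sector {v : S} {d : ℕ} {P : ℂ → S} (hP : PolarChart M.graph M.vert v d P)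
    (hv : v ∈ M.vert) (k : ℤ) : ∃ Φ Ψ : M.Flag, Φ.v = v ∧ Ψ.v = v ∧ polarLeg P k ⊆ Φ.e ∧
      polarLeg P (k + 1) ⊆ Ψ.e ∧ polarSector P k ⊆ Φ.F ∧ polarSector P k ⊆ Ψ.F ∧
      Adj 1 Φ Ψ := by
  obtain ⟨e, he, hke⟩ := exists_leg_subset hP k
  obtain ⟨e', he', hke'⟩ := exists_leg_subset hP (k + 1)
  obtain ⟨A, hA, -, -, hkA, -, -, heA, -⟩ := faces_of_edge hP he hke
  obtain ⟨-, -, B, hB, -, hkB, -, -, heB, -⟩ := faces_of_edge hP he' hke'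
  rw [add_sub_cancel_right] at hkB
  obtain ⟨x, hx⟩ := PolarChart.sector_nonempty P k
  obtain rfl : A = B := face_eq hA hB ⟨x, hkA hx, hkB hx⟩
  refine ⟨⟨v, e, A, hv, he, hA, mem_of_leg_subset hP he hke, heA⟩,
    ⟨v, e', A, hv, he', hA, mem_of_leg_subset hP he' hke', heB⟩,
    rfl, rfl, hke, hke', hkA, hkA, rfl, ?_, rfl, ?_⟩
  · exact edge_ne_of_leg_succ hP hv he hke hke'
  · exact sharesCorner_of_sector hP hke hke' hkA

lemma exists_adj (i : Fin 3) (Φ : M.Flag) : ∃ Ψ, Adj i Φ Ψ := by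
  fin_cases i
  · obtain ⟨a, b, hne, ha, hb, hav, hbv, hab⟩ := eq_or_eq_of_mem_edge Φ.e_mem
    rcases hab _ Φ.v_e Φ.v_mem with h | h
    · exact ⟨⟨b, Φ.e, Φ.F, hbv, Φ.e_mem, Φ.F_mem, hb, Φ.e_F⟩, h ▸ hne, rfl, rfl⟩
    · exact ⟨⟨a, Φ.e, Φ.F, hav, Φ.e_mem, Φ.F_mem, ha, Φ.e_F⟩, h ▸ hne.symm, rfl, rfl⟩
  · obtain ⟨d, P, hP⟩ := exists_polarChart_of_flag Φ
    obtain ⟨k, hk, -⟩ := exists_leg_of_edge hP Φ.e_mem Φ.v_mem Φ.v_e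
    obtain ⟨A, hA, B, hB, hkA, hkB, hAB, -, -, key⟩ := faces_of_edge hP Φ.e_mem hk
    rcases key Φ.F Φ.F_mem Φ.e_F with h | h
    · obtain ⟨Φ', Ψ, h1, -, h2, -, h3, -, h4⟩ := exists_adj_of_sector hP Φ.v_mem k
      obtain ⟨x, hx⟩ := PolarChart.sector_nonempty P k
      have : Φ' = Φ := Flag.ext h1 (edge_eq_of_leg hP Φ'.e_mem Φ.e_mem h2 hk)
        (face_eq Φ'.F_mem Φ.F_mem ⟨x, h3 hx, h ▸ hkA hx⟩)
      exact ⟨Ψ, this ▸ h4⟩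
    · obtain ⟨Ψ, Φ', -, h1, -, h2, -, h3, h4⟩ := exists_adj_of_sector hP Φ.v_mem (k - 1)
      rw [sub_add_cancel] at h2
      obtain ⟨x, hx⟩ := PolarChart.sector_nonempty P (k - 1)
      have : Φ' = Φ := Flag.ext h1 (edge_eq_of_leg hP Φ'.e_mem Φ.e_mem h2 hk)
        (face_eq Φ'.F_mem Φ.F_mem ⟨x, h3 hx, h ▸ hkB hx⟩)
      exact ⟨Ψ, adj_symm (this ▸ h4)⟩
  · obtain ⟨A, B, hne, hA, hB, heA, heB, hAB⟩ := exists_faces_of_edge Φ.e_mem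
    rcases hAB _ Φ.F_mem Φ.e_F with h | h
    · exact ⟨⟨Φ.v, Φ.e, B, Φ.v_mem, Φ.e_mem, hB, Φ.v_e, heB⟩, rfl, rfl, h ▸ hne⟩
    · exact ⟨⟨Φ.v, Φ.e, A, Φ.v_mem, Φ.e_mem, hA, Φ.v_e, heA⟩, rfl, rfl, h ▸ hne.symm⟩

/-- Existence, uniqueness and symmetry of adjacency provide the involution, so the default value in
`r` does not occur. -/
lemma adj_r (i : Fin 3) (Φ : M.Flag) : Adj i Φ (M.r i Φ) := by
  have h : ∃ σ : Equiv.Perm M.Flag, ∀ Φ, Adj i Φ (σ Φ) := by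
    choose f hf using exists_adj (M := M) i
    have hinv : Function.Involutive f := fun Φ => adj_unique (hf (f Φ)) (adj_symm (hf Φ))
    exact ⟨hinv.toPerm, hf⟩
  rw [r, dif_pos h]
  exact h.choose_spec Φ

lemma r_eq {i : Fin 3} {Φ Ψ : M.Flag} (h : Adj i Φ Ψ) : M.r i Φ = Ψ :=
  adj_unique (adj_r i Φ) h

lemma r_r (i : Fin 3) (Φ : M.Flag) : M.r i (M.r i Φ) = Φ :=
  r_eq (adj_symm (adj_r i Φ))

lemma ρ_mul_self (i : Fin 3) : M.ρ i * M.ρ i = 1 :=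
  Subtype.ext (Equiv.ext fun Φ => r_r i Φ)

/-- A homeomorphism carries adjacent flags to adjacent flags, corners included, and adjacent flags
are unique. -/
lemma Aut_r_comm {σ : Equiv.Perm M.Flag} (hσ : σ ∈ M.Aut) (i : Fin 3) (Φ : M.Flag) :
    σ (M.r i Φ) = M.r i (σ Φ) := by
  obtain ⟨h, -, -, hf⟩ := hσ
  symm
  apply r_eq
  obtain ⟨a1, a2, a3⟩ := hf Φ
  obtain ⟨b1, b2, b3⟩ := hf (M.r i Φ)
  have hadj := adj_r i Φ
  fin_cases i
  · obtain ⟨h1, h2, h3⟩ : Φ.v ≠ (M.r 0 Φ).v ∧ Φ.e = (M.r 0 Φ).e ∧ Φ.F = (M.r 0 Φ).F := hadj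
    refine ⟨?_, ?_, ?_⟩
    · rw [a1, b1]; exact fun hh => h1 (h.injective hh)
    · rw [a2, b2]; exact congrArg _ h2
    · rw [a3, b3]; exact congrArg _ h3
  · obtain ⟨h1, h2, h3, h4⟩ : Φ.v = (M.r 1 Φ).v ∧ Φ.e ≠ (M.r 1 Φ).e ∧ Φ.F = (M.r 1 Φ).F ∧
      SharesCorner Φ.v Φ.e (M.r 1 Φ).e Φ.F := hadj
    refine ⟨?_, ?_, ?_, ?_⟩
    · rw [a1, b1]; exact congrArg _ h1
    · rw [a2, b2]; exact fun hh => h2 (h.injective.image_injective hh)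
    · rw [a3, b3]; exact congrArg _ h3
    · rw [a1, a2, a3, b2]; exact sharesCorner_image h h4
  · obtain ⟨h1, h2, h3⟩ : Φ.v = (M.r 2 Φ).v ∧ Φ.e = (M.r 2 Φ).e ∧ Φ.F ≠ (M.r 2 Φ).F := hadj
    refine ⟨?_, ?_, ?_⟩
    · rw [a1, b1]; exact congrArg _ h1
    · rw [a2, b2]; exact congrArg _ h2
    · rw [a3, b3]; exact fun hh => h3 (h.injective.image_injective hh)

lemma Aut_Mon_comm {σ g : Equiv.Perm M.Flag} (hσ : σ ∈ M.Aut) (hg : g ∈ M.Mon) :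
    σ * g = g * σ := by
  have : M.Mon ≤ Subgroup.centralizer {σ} := by
    rw [Mon, Subgroup.closure_le]
    rintro _ ⟨i, rfl⟩
    rw [SetLike.mem_coe, Subgroup.mem_centralizer_singleton_iff]
    exact Equiv.ext fun Φ => (Aut_r_comm hσ i Φ).symm
  exact (Subgroup.mem_centralizer_singleton_iff.1 (this hg)).symm

/-- A set of flags closed under the involutions that contains one flag at a vertex contains all
flags at this vertex. -/
lemma flags_at_vertex {O : Set M.Flag} (hO : ∀ i, ∀ Φ ∈ O, M.r i Φ ∈ O) {Φ : M.Flag}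
    (hΦ : Φ ∈ O) {Ψ : M.Flag} (hv : Ψ.v = Φ.v) : Ψ ∈ O := by
  obtain ⟨d, P, hP⟩ := exists_polarChart_of_flag Φ
  have same_edge : ∀ Φ Ψ : M.Flag, Φ ∈ O → Ψ.v = Φ.v → Ψ.e = Φ.e → Ψ ∈ O := by
    intro Φ Ψ hΦ h1 h2
    by_cases h3 : Ψ.F = Φ.F
    · rwa [Flag.ext h1 h2 h3]
    · rw [← r_eq (i := 2) (Φ := Φ) (Ψ := Ψ) ⟨h1.symm, h2.symm, Ne.symm h3⟩]
      exact hO _ _ hΦ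
  have same_leg : ∀ Φ' Ψ : M.Flag, ∀ k, Φ' ∈ O → Φ'.v = Φ.v → Ψ.v = Φ.v → polarLeg P k ⊆ Φ'.e →
      polarLeg P k ⊆ Ψ.e → Ψ ∈ O := fun Φ' Ψ k h h1 h2 h3 h4 =>
    same_edge Φ' Ψ h (h2.trans h1.symm) (edge_eq_of_leg hP Ψ.e_mem Φ'.e_mem h4 h3)
  -- Crossing a sector by `r 1` leads to the next leg, and `r 2` changes the face at an edge; so all
  -- legs are reached by induction.
  have up : ∀ k, (∀ Ψ : M.Flag, Ψ.v = Φ.v → polarLeg P k ⊆ Ψ.e → Ψ ∈ O) →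
      ∀ Ψ : M.Flag, Ψ.v = Φ.v → polarLeg P (k + 1) ⊆ Ψ.e → Ψ ∈ O := by
    intro k hk Ψ hΨ hkΨ
    obtain ⟨X, Y, h1, h2, h3, h4, -, -, h5⟩ := exists_adj_of_sector hP Φ.v_mem k
    have hY : Y ∈ O := r_eq h5 ▸ hO 1 X (hk X h1 h3)
    exact same_leg Y Ψ (k + 1) hY h2 hΨ h4 hkΨ
  have down : ∀ k, (∀ Ψ : M.Flag, Ψ.v = Φ.v → polarLeg P (k + 1) ⊆ Ψ.e → Ψ ∈ O) →
      ∀ Ψ : M.Flag, Ψ.v = Φ.v → polarLeg P k ⊆ Ψ.e → Ψ ∈ O := by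
    intro k hk Ψ hΨ hkΨ
    obtain ⟨X, Y, h1, h2, h3, h4, -, -, h5⟩ := exists_adj_of_sector hP Φ.v_mem k
    have hX : X ∈ O := r_eq (adj_symm h5) ▸ hO 1 Y (hk Y h2 h4)
    exact same_leg X Ψ k hX h1 hΨ h3 hkΨ
  obtain ⟨k₀, hk₀, -⟩ := exists_leg_of_edge hP Φ.e_mem Φ.v_mem Φ.v_e
  obtain ⟨k, hk, -⟩ := exists_leg_of_edge hP Ψ.e_mem Φ.v_mem (hv ▸ Ψ.v_e)
  have all : ∀ k, ∀ Ψ : M.Flag, Ψ.v = Φ.v → polarLeg P k ⊆ Ψ.e → Ψ ∈ O := by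
    intro k
    induction k using Int.inductionOn' (b := k₀) with
    | zero => exact fun Ψ h1 h2 => same_leg Φ Ψ k₀ hΦ rfl h1 hk₀ h2
    | succ k _ ih => exact up k ih
    | pred k _ ih => exact down (k - 1) (by rwa [sub_add_cancel])
  exact all k Ψ hv hk

/-- The monodromy group is transitive on the flags. -/
lemma exists_Mon_apply_eq (Φ Ψ : M.Flag) : ∃ g ∈ M.Mon, g Φ = Ψ := by
  set O : Set M.Flag := {Ψ | ∃ g ∈ M.Mon, g Φ = Ψ} with hOdef
  have hO : ∀ i, ∀ Φ ∈ O, M.r i Φ ∈ O := by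
    rintro i _ ⟨g, hg, rfl⟩
    exact ⟨M.r i * g, M.Mon.mul_mem (Subgroup.subset_closure ⟨i, rfl⟩) hg, rfl⟩
  have hΦ : Φ ∈ O := ⟨1, M.Mon.one_mem, rfl⟩
  set W : Set S := Flag.v '' O with hW
  have hWv : W ⊆ M.vert := by rintro _ ⟨Φ, -, rfl⟩; exact Φ.v_mem
  have hflag : ∀ Ψ : M.Flag, Ψ.v ∈ W → Ψ ∈ O := by
    rintro Ψ ⟨Φ', hΦ', h⟩
    exact flags_at_vertex hO hΦ' h.symm
  -- an edge with one end in `W` has both ends in `W`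
  have hedge : ∀ e ∈ M.edge, ∀ x ∈ e, x ∈ W → ∀ y ∈ e, y ∈ M.vert → y ∈ W := by
    intro e he x hx hxW y hy hyv
    obtain ⟨A, -, -, hA, -, heA, -⟩ := exists_faces_of_edge he
    by_cases hxy : x = y
    · exact hxy ▸ hxW
    · let X : M.Flag := ⟨x, e, A, hWv hxW, he, hA, hx, heA⟩
      let Y : M.Flag := ⟨y, e, A, hyv, he, hA, hy, heA⟩
      have : M.r 0 X = Y := r_eq (i := 0) ⟨hxy, rfl, rfl⟩
      exact ⟨Y, this ▸ hO 0 X (hflag X hxW), rfl⟩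
  -- The reached vertices with their edges, and the remaining vertices and edges, are closed sets
  -- covering the connected graph. By `hedge` they are disjoint, so no vertex remains.
  set E₁ : Set (Set S) := {e ∈ M.edge | (e ∩ W).Nonempty} with hE₁
  set E₂ : Set (Set S) := {e ∈ M.edge | ¬ (e ∩ W).Nonempty} with hE₂
  have hconn := isPreconnected_closed_iff.1 M.graph_connected.isPreconnected
    (W ∪ ⋃₀ E₁) ((M.vert \ W) ∪ ⋃₀ E₂)
    ((isClosed_of_subset_vert hWv).union (isClosed_sUnion_edge fun e h => h.1))
    ((isClosed_of_subset_vert Set.sdiff_subset).union (isClosed_sUnion_edge fun e h => h.1)) ?_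
    ⟨Φ.v, Or.inl Φ.v_mem, Or.inl ⟨Φ, hΦ, rfl⟩⟩
  · by_contra hΨ
    have hΨW : Ψ.v ∉ W := fun h => hΨ (hflag Ψ h)
    obtain ⟨x, -, hx1, hx2⟩ := hconn ⟨Ψ.v, Or.inl Ψ.v_mem, Or.inl ⟨Ψ.v_mem, hΨW⟩⟩
    rcases hx1 with hx1 | ⟨e, ⟨he, y, hye, hyW⟩, hxe⟩ <;>
      rcases hx2 with hx2 | ⟨e', ⟨he', hn⟩, hxe'⟩
    · exact hx2.2 hx1
    · exact hn ⟨x, hxe', hx1⟩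
    · exact hx2.2 (hedge e he y hye hyW x hxe hx2.1)
    · by_cases hxv : x ∈ M.vert
      · exact hn ⟨x, hxe', hedge e he y hye hyW x hxe hxv⟩
      · obtain rfl := edge_eq he he' hxe hxe' hxv
        exact hn ⟨y, hye, hyW⟩
  · rintro x (hx | ⟨e, he, hxe⟩)
    · by_cases hxW : x ∈ W
      · exact Or.inl (Or.inl hxW)
      · exact Or.inr (Or.inl ⟨hx, hxW⟩)
    · by_cases hne : (e ∩ W).Nonempty
      · exact Or.inl (Or.inr ⟨e, ⟨he, hne⟩, hxe⟩)
      · exact Or.inr (Or.inr ⟨e, ⟨he, hne⟩, hxe⟩)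

end SurfaceMap

/-! ### Cayley graphs of virtually abelian groups -/

/-- A relation on `ℤ^m`, `m ≥ 2`, that relates neighbouring points outside a cube relates all points
outside this cube. -/
lemma rel_of_outside_cube {m : ℕ} (hm : 2 ≤ m) {R : ℤ} (hR : 0 ≤ R)
    {r : (Fin m → ℤ) → (Fin m → ℤ) → Prop} (hr : Equivalence r)
    (hstep : ∀ x, (∃ i, R < |x i|) → (∀ j, r x (x + Pi.single j 1)))
    (x : Fin m → ℤ) (hx : ∃ i, R < |x i|) : r x fun _ => R + 1 := by
  -- While some other coordinate is large, coordinate `j` can be changed at will without entering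
  -- the cube.
  have update : ∀ (x : Fin m → ℤ) (j : Fin m), (∃ i, i ≠ j ∧ R < |x i|) →
      ∀ a, r x (Function.update x j a) := by
    rintro x j ⟨i, hij, hi⟩ a
    have hs : ∀ b, r (Function.update x j b) (Function.update x j (b + 1)) := by
      intro b
      have := hstep (Function.update x j b) ⟨i, by rwa [Function.update_of_ne hij]⟩ j
      convert this using 1
      ext k
      rcases eq_or_ne k j with rfl | h
      · simp
      · simp [h]
    induction a using Int.inductionOn' (b := x j) with
    | zero => rw [Function.update_eq_self]; exact hr.refl x
    | succ k _ ih => exact hr.trans ih (hs k)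
    | pred k _ ih =>
      have := hs (k - 1)
      rw [sub_add_cancel] at this
      exact hr.trans ih (hr.symm this)
  obtain ⟨i, hi⟩ := hx
  have hset : ∀ s : Finset (Fin m), i ∉ s → r x fun k => if k ∈ s then R + 1 else x k := by
    intro s
    induction s using Finset.induction_on with
    | empty => intro _; simpa using hr.refl x
    | insert j s _ ih =>
      intro his
      rw [Finset.mem_insert, not_or] at his
      refine hr.trans (ih his.2) ?_
      have := update (fun k => if k ∈ s then R + 1 else x k) j ⟨i, his.1, by simp [his.2, hi]⟩ (R + 1)
      convert this using 1
      ext k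
      rcases eq_or_ne k j with rfl | h
      · simp
      · simp [h]
  have h1 := hset (Finset.univ.erase i) (by simp)
  have : Nontrivial (Fin m) := Fin.nontrivial_iff_two_le.2 hm
  -- Here `2 ≤ m` enters: coordinate `j`, already equal to `R + 1`, keeps the path outside the cube
  -- while coordinate `i` is adjusted.
  obtain ⟨j, hj⟩ := exists_ne i
  have h2 := update (fun k => if k ∈ Finset.univ.erase i then R + 1 else x k) i
    ⟨j, hj, by simp [hj]; rw [abs_of_nonneg] <;> linarith⟩ (R + 1)
  have h3 : Function.update (fun k => if k ∈ Finset.univ.erase i then R + 1 else x k) i (R + 1) =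
      fun _ => R + 1 := by
    ext k
    rcases eq_or_ne k i with rfl | h
    · simp
    · simp [h]
  rw [h3] at h2
  exact hr.trans h1 h2

section CayleyGraph

variable {G : Type*} [Group G]

/-- `g` and `h` are joined by a path in the Cayley graph with respect to the `ρ i`
that avoids `A`. -/
def CayleyRel {ι : Type*} (ρ : ι → G) (A : Set G) : G → G → Prop :=
  Relation.ReflTransGen fun g h => g ∉ A ∧ h ∉ A ∧ ∃ i, h = g * ρ i

variable {ι : Type*} {ρ : ι → G}

lemma CayleyRel.equivalence (hinv : ∀ i, ρ i * ρ i = 1) (A : Set G) :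
    Equivalence (CayleyRel ρ A) where
  refl _ := Relation.ReflTransGen.refl
  trans := Relation.ReflTransGen.trans
  symm h := by
    have : Std.Symm fun g h => g ∉ A ∧ h ∉ A ∧ ∃ i, h = g * ρ i := by
      refine ⟨?_⟩
      rintro g _ ⟨h1, h2, i, rfl⟩
      exact ⟨h2, h1, i, by rw [mul_assoc, hinv, mul_one]⟩
    exact (Relation.ReflTransGen.stdSymm (r := _)).symm _ _ h

/-- For every `t` the points `g` and `g * t` are joined by a path near `g`. -/
lemma exists_finite_cayleyRel (hinv : ∀ i, ρ i * ρ i = 1)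
    (hgen : Subgroup.closure (Set.range ρ) = ⊤) (t : G) :
    ∃ Q : Set G, Q.Finite ∧ ∀ (A : Set G) (g : G), (∀ q ∈ Q, g * q ∉ A) →
      CayleyRel ρ A g (g * t) := by
  have ht : t ∈ Subgroup.closure (Set.range ρ) := hgen ▸ Subgroup.mem_top t
  induction ht using Subgroup.closure_induction with
  | mem t ht =>
    obtain ⟨i, rfl⟩ := ht
    refine ⟨{1, ρ i}, Set.toFinite _, fun A g hg => Relation.ReflTransGen.single ⟨?_, ?_, i, rfl⟩⟩
    · simpa using hg 1 (by simp)
    · exact hg _ (by simp)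
  | one =>
    refine ⟨∅, Set.finite_empty, fun A g _ => ?_⟩
    rw [mul_one]
    exact Relation.ReflTransGen.refl
  | mul s t _ _ hs ht =>
    obtain ⟨Q, hQ, h1⟩ := hs
    obtain ⟨Q', hQ', h2⟩ := ht
    refine ⟨Q ∪ (s * ·) '' Q', hQ.union (hQ'.image _), fun A g hg => ?_⟩
    rw [← mul_assoc]
    refine (h1 A g fun q hq => hg q (Or.inl hq)).trans (h2 A _ fun q hq => ?_)
    rw [mul_assoc]
    exact hg _ (Or.inr ⟨q, hq, rfl⟩)
  | inv t _ ht =>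
    obtain ⟨Q, hQ, h1⟩ := ht
    refine ⟨(t⁻¹ * ·) '' Q, hQ.image _, fun A g hg => ?_⟩
    have := h1 A (g * t⁻¹) fun q hq => by
      rw [mul_assoc]
      exact hg _ ⟨q, hq, rfl⟩
    rw [inv_mul_cancel_right] at this
    exact (CayleyRel.equivalence hinv A).symm this

/-- A Cayley graph of a group that is virtually `ℤ^m` with `m ≥ 2` has only one end. -/
theorem exists_finite_forall_cayleyRel [Finite ι] (hinv : ∀ i, ρ i * ρ i = 1)
    (hgen : Subgroup.closure (Set.range ρ) = ⊤) (N : Subgroup G) [N.FiniteIndex] {m : ℕ}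
    (hm : 2 ≤ m) (e : N ≃* Multiplicative (Fin m → ℤ)) {A : Set G} (hA : A.Finite) :
    ∃ A' : Set G, A'.Finite ∧ ∃ p, ∀ g ∉ A', CayleyRel ρ A g p := by
  have hE := CayleyRel.equivalence hinv A
  choose Q hQ hpath using exists_finite_cayleyRel hinv hgen
  let ν : (Fin m → ℤ) → G := fun x => e.symm (Multiplicative.ofAdd x)
  have hν : Function.Injective ν := fun x y h =>
    Multiplicative.ofAdd.injective (e.symm.injective (Subtype.ext h))
  have hνadd : ∀ x y, ν (x + y) = ν x * ν y := fun x y => by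
    simp only [ν, ofAdd_add, map_mul, Subgroup.coe_mul]
  have hνN : ∀ n ∈ N, ∃ x, n = ν x := fun n hn =>
    ⟨Multiplicative.toAdd (e ⟨n, hn⟩), by simp [ν]⟩
  -- the lattice points near `A`
  let B : Set (Fin m → ℤ) := {x | ∃ j, ∃ q ∈ Q (ν (Pi.single j 1)), ν x * q ∈ A}
  have hB : B.Finite := by
    have : ν '' B ⊆ ⋃ j, (fun p : G × G => p.1 * p.2⁻¹) '' (A ×ˢ Q (ν (Pi.single j 1))) := by
      rintro _ ⟨x, ⟨j, q, hq, hx⟩, rfl⟩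
      exact Set.mem_iUnion.2 ⟨j, (ν x * q, q), ⟨hx, hq⟩, by simp⟩
    exact Set.Finite.of_finite_image
      ((Set.finite_iUnion fun j => (hA.prod (hQ _)).image _).subset this) hν.injOn
  obtain ⟨R, hR0, hR⟩ : ∃ R : ℤ, 0 ≤ R ∧ ∀ x ∈ B, ∀ i, |x i| ≤ R := by
    obtain ⟨R, hR⟩ := (hB.image fun x => ∑ i, |x i|).bddAbove
    refine ⟨max R 0, le_max_right _ _, fun x hx i => le_trans ?_ (le_max_left _ _)⟩
    exact (Finset.single_le_sum (f := fun i => |x i|) (fun _ _ => abs_nonneg _)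
      (Finset.mem_univ i)).trans (hR ⟨x, hx, rfl⟩)
  have hfar : ∀ x : Fin m → ℤ, (∃ i, R < |x i|) → CayleyRel ρ A (ν x) (ν fun _ => R + 1) := by
    refine rel_of_outside_cube hm hR0 (r := fun x y => CayleyRel ρ A (ν x) (ν y))
      ⟨fun _ => hE.refl _, hE.symm, hE.trans⟩ ?_
    rintro x ⟨i, hi⟩ j
    rw [hνadd]
    refine hpath _ A _ fun q hq hqA => ?_
    exact absurd (hR x ⟨j, q, hq, hqA⟩ i) (not_le.2 hi)
  let C : Set (Fin m → ℤ) := {x | ∀ i, |x i| ≤ R}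
  have hC : C.Finite := by
    refine (Set.finite_Icc (fun _ => -R) (fun _ : Fin m => R)).subset fun x hx => ⟨?_, ?_⟩
    · exact fun i => (abs_le.1 (hx i)).1
    · exact fun i => (abs_le.1 (hx i)).2
  -- Right multiplication by a representative of the left coset of `g⁻¹` takes `g` into `N`. The
  -- exceptional set consists of those `g` whose path into `N` may hit `A`, or which end in the cube
  -- `C`.
  let τ : G ⧸ N → G := Quotient.out
  refine ⟨(⋃ c, (fun p : G × G => p.1 * p.2⁻¹) '' (A ×ˢ Q (τ c))) ∪
    (⋃ c, (fun x => ν x * (τ c)⁻¹) '' C), ?_, ν fun _ => R + 1, fun g hg => ?_⟩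
  · exact (Set.finite_iUnion fun c => (hA.prod (hQ _)).image _).union
      (Set.finite_iUnion fun c => hC.image _)
  · let c : G ⧸ N := QuotientGroup.mk g⁻¹
    have hc : g * τ c ∈ N := by
      have := QuotientGroup.eq.1 (show QuotientGroup.mk g⁻¹ = QuotientGroup.mk (τ c) from
        (Quotient.out_eq c).symm)
      rwa [inv_inv] at this
    obtain ⟨x, hx⟩ := hνN _ hc
    have h1 : CayleyRel ρ A g (g * τ c) := by
      refine hpath _ A g fun q hq hqA => hg (Or.inl ?_)
      exact Set.mem_iUnion.2 ⟨c, (g * q, q), ⟨hqA, hq⟩, by simp⟩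
    rw [hx] at h1
    refine hE.trans h1 (hfar x ?_)
    by_contra hcon
    push Not at hcon
    exact hg (Or.inr (Set.mem_iUnion.2 ⟨c, x, hcon, by
      show ν x * (τ c)⁻¹ = g
      rw [← hx, mul_inv_cancel_right]⟩))

end CayleyGraph

/-! ### The monodromy group is virtually free abelian -/

lemma exists_mulEquiv_of_isMulTorsionFree (N : Type*) [CommGroup N] [Group.FG N]
    [IsMulTorsionFree N] : ∃ m, Nonempty (N ≃* Multiplicative (Fin m → ℤ)) :=
  ⟨_, ⟨AddEquiv.toMultiplicativeRight
    (Module.finBasis ℤ (Additive N)).equivFun.toAddEquiv⟩⟩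

/-- Multiplication by `k` embeds `ℤ^n` into the range of `f`, whose rank is at most `m`. -/
lemma le_of_forall_pow_mem_range {m n : ℕ}
    (f : Multiplicative (Fin m → ℤ) →* Multiplicative (Fin n → ℤ)) {k : ℕ} (hk : k ≠ 0)
    (hf : ∀ z, z ^ k ∈ f.range) : n ≤ m := by
  let F : (Fin m → ℤ) →ₗ[ℤ] (Fin n → ℤ) := (MonoidHom.toAdditive f).toIntLinearMap
  let K : (Fin n → ℤ) →ₗ[ℤ] LinearMap.range F :=
    LinearMap.codRestrict _ ((k : ℤ) • LinearMap.id) fun z => by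
      obtain ⟨w, hw⟩ := hf (Multiplicative.ofAdd z)
      refine ⟨w.toAdd, ?_⟩
      have : F w.toAdd = k • z := congrArg Multiplicative.toAdd hw
      simpa using this
  have hK : Function.Injective K := by
    intro x y h
    have h1 := congrArg Subtype.val h
    have h2 : (k : ℤ) • x = (k : ℤ) • y := h1
    exact smul_right_injective _ (by exact_mod_cast hk) h2
  have h1 := LinearMap.finrank_le_finrank_of_injective hK
  have h2 := LinearMap.finrank_range_le F
  simp only [Module.finrank_fin_fun] at h1 h2
  exact h1.trans h2

/-- A finitely generated transitive permutation group which commutes with a faithful action of `ℤ^n`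
with finitely many orbits is virtually `ℤ^m` for some `m ≥ n`. -/
theorem exists_finiteIndex_mulEquiv {G X : Type*} [Group G] [Group.FG G] [Nonempty X]
    (α : G →* Equiv.Perm X) (hα : Function.Injective α) (htrans : ∀ x y, ∃ g, α g x = y)
    {n : ℕ} (θ : Multiplicative (Fin n → ℤ) →* Equiv.Perm X) (hθ : Function.Injective θ)
    (hcomm : ∀ z g x, θ z (α g x) = α g (θ z x))
    {R : Set X} (hR : R.Finite) (horb : ∀ x, ∃ z, ∃ y ∈ R, x = θ z y) :
    ∃ N : Subgroup G, N.FiniteIndex ∧ ∃ m, n ≤ m ∧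
      Nonempty (N ≃* Multiplicative (Fin m → ℤ)) := by
  have hmul : ∀ z w x, θ (z * w) x = θ z (θ w x) := fun z w x => by rw [map_mul]; rfl
  have hαmul : ∀ g h x, α (g * h) x = α g (α h x) := fun g h x => by rw [map_mul]; rfl
  -- The fixed points of `z` are permuted by the commuting transitive group, so one fixed point
  -- makes all points fixed.
  have hfree : ∀ z x, θ z x = x → z = 1 := by
    intro z x hz
    apply hθ
    ext y
    obtain ⟨g, rfl⟩ := htrans x y
    rw [hcomm, hz, map_one]
    rfl
  have hfree' : ∀ z w x, θ z x = θ w x → z = w := by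
    intro z w x h
    rw [← inv_mul_eq_one]
    refine hfree _ (x) ?_
    rw [hmul, ← h, ← hmul, inv_mul_cancel, map_one]
    rfl
  let s : Setoid X :=
    { r := fun x y => ∃ z, y = θ z x
      iseqv :=
        { refl := fun x => ⟨1, by rw [map_one]; rfl⟩
          symm := by
            rintro x _ ⟨z, rfl⟩
            exact ⟨z⁻¹, by rw [← hmul, inv_mul_cancel, map_one]; rfl⟩
          trans := by
            rintro x _ _ ⟨z, rfl⟩ ⟨w, rfl⟩
            exact ⟨w * z, (hmul _ _ _).symm⟩ } }
  have hQ : Finite (Quotient s) := by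
    have := hR.to_subtype
    refine Finite.of_surjective (fun y : R => (Quotient.mk s y.1)) fun q => ?_
    obtain ⟨x, rfl⟩ := Quotient.exists_rep q
    obtain ⟨z, y, hy, rfl⟩ := horb x
    exact ⟨⟨y, hy⟩, Quotient.sound ⟨z, rfl⟩⟩
  have hs : ∀ g x y, s x y → s (α g x) (α g y) := by
    rintro g x _ ⟨z, rfl⟩
    exact ⟨z, (hcomm z g x).symm⟩
  -- The action on the finitely many lattice orbits; its kernel preserves each orbit.
  let π : G →* Function.End (Quotient s) :=
    { toFun := fun g => Quotient.map (α g) (hs g)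
      map_one' := by
        funext q
        obtain ⟨x, rfl⟩ := Quotient.exists_rep q
        simp [Function.End.one_def]
      map_mul' := fun g h => by
        funext q
        obtain ⟨x, rfl⟩ := Quotient.exists_rep q
        exact congrArg (Quotient.mk s) (hαmul g h x) }
  let π' := π.toHomUnits
  have hQ' : Finite (Function.End (Quotient s)) :=
    inferInstanceAs (Finite (Quotient s → Quotient s))
  let N : Subgroup G := π'.ker
  have hNfin : N.FiniteIndex := Subgroup.finiteIndex_ker π'
  have hN : ∀ g : N, ∀ x, ∃ z, α g x = θ z x := by
    rintro ⟨g, hg⟩ x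
    have h1 : π g = 1 := congrArg Units.val (MonoidHom.mem_ker.1 hg)
    have h2 : Quotient.mk s (α g x) = Quotient.mk s x := congrFun h1 (Quotient.mk s x)
    exact s.symm (Quotient.exact h2)
  choose c hc using hN
  -- The lattice commutes with `G`, so the displacement of `x` under `h` is also that of its
  -- translates; commutativity of `ℤ^n` fixes the order of the factors.
  have hcmul : ∀ g h x, c (g * h) x = c g x * c h x := by
    intro g h x
    refine hfree' _ _ x ?_
    rw [← hc, Subgroup.coe_mul, hαmul, hc h, ← hcomm, hc g, ← hmul, mul_comm]
  let C : N →* (X → Multiplicative (Fin n → ℤ)) :=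
    MonoidHom.mk' c fun g h => funext fun x => hcmul g h x
  have hC : Function.Injective C := by
    intro g h hgh
    refine Subtype.ext (hα (Equiv.ext fun x => ?_))
    rw [hc, hc]
    exact congrArg (fun z => θ z x) (congrFun hgh x)
  let _ : CommGroup N :=
    { (inferInstance : Group N) with
      mul_comm := fun g h => hC (by rw [map_mul, map_mul, mul_comm]) }
  have : Group.FG N := N.fg_of_index_ne_zero
  have : IsMulTorsionFree N := Function.Injective.isMulTorsionFree C hC
  obtain ⟨m, ⟨e⟩⟩ := exists_mulEquiv_of_isMulTorsionFree N
  refine ⟨N, hNfin, m, ?_, ⟨e⟩⟩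
  obtain ⟨x⟩ := ‹Nonempty X›
  -- The exponent `k` sends every `g` into `N`. If `g` moves `x` as `z` does, then `g ^ k` moves it
  -- as `z ^ k`, so `z ^ k` is a value of `c · x`.
  let k := Nat.card (Function.End (Quotient s))ˣ
  refine le_of_forall_pow_mem_range (((Pi.evalMonoidHom _ x).comp C).comp e.symm.toMonoidHom)
    (k := k) Nat.card_pos.ne' fun z => ?_
  obtain ⟨g, hg⟩ := htrans x (θ z x)
  have hpow : ∀ j : ℕ, α (g ^ j) x = θ (z ^ j) x := by
    intro j
    induction j with
    | zero => simp
    | succ j ih => rw [pow_succ, pow_succ', hαmul, hg, ← hcomm, ih, hmul]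
  have hgN : g ^ k ∈ N := by
    rw [MonoidHom.mem_ker, map_pow, pow_card_eq_one']
  refine ⟨e ⟨g ^ k, hgN⟩, ?_⟩
  refine hfree' _ _ x ?_
  rw [← hpow]
  have : ((Pi.evalMonoidHom _ x).comp C).comp e.symm.toMonoidHom (e ⟨g ^ k, hgN⟩) =
      c ⟨g ^ k, hgN⟩ x := by
    simp [C]
  rw [this, ← hc]

lemma infinite_of_finiteIndex_mulEquiv {G : Type*} [Group G] (N : Subgroup G) {m : ℕ} (hm : 2 ≤ m)
    (e : N ≃* Multiplicative (Fin m → ℤ)) : Infinite G := by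
  have : Nonempty (Fin m) := ⟨⟨0, by omega⟩⟩
  have h1 : Infinite (Multiplicative (Fin m → ℤ)) := inferInstanceAs (Infinite (Fin m → ℤ))
  have : Infinite N := Infinite.of_injective _ e.symm.injective
  exact Infinite.of_injective _ N.subtype_injective

namespace SurfaceMap

variable {S : Type*} [TopologicalSpace S] {M : SurfaceMap S}

lemma closure_range_ρ : Subgroup.closure (Set.range M.ρ) = ⊤ := by
  apply Subgroup.map_injective M.Mon.subtype_injective
  rw [MonoidHom.map_closure, ← Set.range_comp, ← MonoidHom.range_eq_map, Subgroup.range_subtype]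
  rfl

theorem exists_finiteIndex_Mon [T2Space S] {n : ℕ} (hn : 2 ≤ n)
    (hAut : ∃ H : Subgroup M.Aut, H.FiniteIndex ∧
      Nonempty (H ≃* Multiplicative (Fin n → ℤ)))
    (hOrb : Finite (MulAction.orbitRel.Quotient M.Aut M.Flag)) :
    ∃ N : Subgroup M.Mon, N.FiniteIndex ∧ ∃ m, 2 ≤ m ∧
      Nonempty (N ≃* Multiplicative (Fin m → ℤ)) := by
  obtain ⟨H, hH, ⟨e⟩⟩ := hAut
  let θ : Multiplicative (Fin n → ℤ) →* Equiv.Perm M.Flag :=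
    (M.Aut.subtype.comp H.subtype).comp e.symm.toMonoidHom
  have hθ : Function.Injective θ :=
    (M.Aut.subtype_injective.comp H.subtype_injective).comp e.symm.injective
  -- With no flags the permutation group would be trivial and could not contain `ℤ^n`.
  have hne : Nonempty M.Flag := by
    by_contra hemp
    rw [not_nonempty_iff] at hemp
    have h1 : Multiplicative.ofAdd (fun _ : Fin n => (1 : ℤ)) = 1 := hθ (Subsingleton.elim _ _)
    have h2 := congrFun (congrArg Multiplicative.toAdd h1) ⟨0, by omega⟩
    simp at h2
  have : Group.FG M.Mon := Group.fg_iff.2 ⟨_, closure_range_ρ, Set.finite_range _⟩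
  let τ : M.Aut ⧸ H → M.Aut := Quotient.out
  let o : MulAction.orbitRel.Quotient M.Aut M.Flag → M.Flag := Quotient.out
  obtain ⟨N, hN, m, hm, hNm⟩ := exists_finiteIndex_mulEquiv M.Mon.subtype
    M.Mon.subtype_injective (fun Φ Ψ => by
      obtain ⟨g, hg, h⟩ := exists_Mon_apply_eq Φ Ψ
      exact ⟨⟨g, hg⟩, h⟩) θ hθ
    (fun z g Φ => Equiv.congr_fun (Aut_Mon_comm (e.symm z).1.2 g.2) Φ)
    -- Since `σ = (σ * τ c) * (τ c)⁻¹` with `σ * τ c ∈ H`, these finitely many flags meet every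
    -- `H`-orbit.
    (R := Set.range fun p : (M.Aut ⧸ H) × MulAction.orbitRel.Quotient M.Aut M.Flag =>
      (τ p.1)⁻¹ • o p.2) (Set.finite_range _) (fun Φ => by
      let q : MulAction.orbitRel.Quotient M.Aut M.Flag := Quotient.mk _ Φ
      obtain ⟨σ, hσ⟩ : Φ ∈ MulAction.orbit M.Aut (o q) :=
        Quotient.exact (s := MulAction.orbitRel M.Aut M.Flag) (Quotient.out_eq q).symm
      let c : M.Aut ⧸ H := QuotientGroup.mk σ⁻¹
      have hc : σ * τ c ∈ H := by
        have := QuotientGroup.eq.1 (show QuotientGroup.mk σ⁻¹ = QuotientGroup.mk (τ c) from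
          (Quotient.out_eq c).symm)
        rwa [inv_inv] at this
      refine ⟨e ⟨σ * τ c, hc⟩, _, ⟨(c, q), rfl⟩, ?_⟩
      have h1 : θ (e ⟨σ * τ c, hc⟩) = ((σ * τ c : M.Aut) : Equiv.Perm M.Flag) := by
        simp [θ]
      rw [h1, ← hσ]
      show _ = (σ * τ c) • ((τ c)⁻¹ • o q)
      rw [smul_smul, mul_inv_cancel_right])
  exact ⟨N, hN, m, hn.trans hm, hNm⟩

end SurfaceMap

/-! ### A criterion for having exactly one end -/

/-- A space has exactly one end if it is not compact and the complement of every compact set `K`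
has a component that contains the complement of a larger compact set. -/
theorem TopEnd.exists_unique_of_forall_compacts {X : Type*} [TopologicalSpace X]
    (hne : ∀ L : TopologicalSpace.Compacts X, ((L : Set X)ᶜ).Nonempty)
    (h : ∀ K : TopologicalSpace.Compacts X, ∃ L : TopologicalSpace.Compacts X,
      ∃ x ∈ (K : Set X)ᶜ, (L : Set X)ᶜ ⊆ connectedComponentIn (K : Set X)ᶜ x) :
    ∃ E : TopEnd X, ∀ E' : TopEnd X, E' = E := by
  choose L x hx hL using h
  refine ⟨⟨fun K => connectedComponentIn (K : Set X)ᶜ (x K), fun K => ⟨x K, hx K, rfl⟩, ?_⟩, ?_⟩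
  · intro K K' hK
    -- A point outside both `L K` and `L K'` lies in both chosen components, which makes them
    -- nested.
    obtain ⟨y, hy⟩ := hne (L K ⊔ L K')
    rw [TopologicalSpace.Compacts.coe_sup, Set.compl_union] at hy
    rw [connectedComponentIn_eq (hL K hy.1), connectedComponentIn_eq (hL K' hy.2)]
    exact connectedComponentIn_mono _ (Set.compl_subset_compl.2 hK)
  · intro E'
    refine TopEnd.ext (funext fun K => ?_)
    obtain ⟨y, hyK, hy⟩ := E'.isComponent K
    -- The value of `E'` at `K ⊔ L K` has a point outside `L K`, which lies in the chosen component
    -- for `K`.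
    obtain ⟨z, hz, hz'⟩ := E'.isComponent (K ⊔ L K)
    have h1 : z ∈ E'.toFun K :=
      E'.anti K (K ⊔ L K) le_sup_left (hz' ▸ mem_connectedComponentIn hz)
    rw [TopologicalSpace.Compacts.coe_sup, Set.compl_union] at hz
    show E'.toFun K = connectedComponentIn (K : Set X)ᶜ (x K)
    rw [hy] at h1 ⊢
    rw [connectedComponentIn_eq h1, connectedComponentIn_eq (hL K hz.2)]

/-! ### Triangles, missing corners and compact sets in the cover -/

namespace SurfaceMap

variable {S : Type*} [TopologicalSpace S] (M : SurfaceMap S)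

/-- The corner `i` is left out from the triangles of the cover. -/
def IsMissingCorner (i : Fin 3) : Prop :=
  ∃ j k : Fin 3, j ≠ i ∧ k ≠ i ∧ ¬ IsOfFinOrder (M.ρ j * M.ρ k)

variable {M}

lemma isEmbedding_triangle_coe : IsEmbedding fun t : M.Triangle => (t.1.1 : Fin 3 → ℝ) :=
  IsEmbedding.subtypeVal.comp IsEmbedding.subtypeVal

lemma Triangle.lt_one (t : M.Triangle) {i : Fin 3} (hi : M.IsMissingCorner i) : t.1.1 i < 1 := by
  refine lt_of_le_of_ne ?_ fun h => ?_
  · exact (Finset.single_le_sum (fun j _ => t.1.2.1 j) (Finset.mem_univ i)).trans_eq t.1.2.2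
  · obtain ⟨j, k, hj, hk, hjk⟩ := hi
    exact hjk (t.2 i h j k hj hk)

/-- Seen in `ℝ³`, leaving out corners is a strict linear inequality, so convexity and compactness
arguments apply to triangles. -/
lemma triangle_coe_image (Q : Set (Fin 3 → ℝ)) :
    (fun t : M.Triangle => (t.1.1 : Fin 3 → ℝ)) '' {t | t.1.1 ∈ Q} =
      stdSimplex ℝ (Fin 3) ∩ Q ∩ {x | ∀ i, M.IsMissingCorner i → x i < 1} := by
  ext x
  constructor
  · rintro ⟨t, ht, rfl⟩
    exact ⟨⟨t.1.2, ht⟩, fun i hi => t.lt_one hi⟩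
  · rintro ⟨⟨h1, h2⟩, h3⟩
    refine ⟨⟨⟨x, h1⟩, fun i hi j k hj hk => ?_⟩, h2, rfl⟩
    by_contra hjk
    exact absurd hi (h3 i ⟨j, k, hj, hk, hjk⟩).ne

lemma isPreconnected_triangle {Q : Set (Fin 3 → ℝ)} (hQ : Convex ℝ Q) :
    IsPreconnected {t : M.Triangle | t.1.1 ∈ Q} := by
  rw [← isEmbedding_triangle_coe.isInducing.isPreconnected_image, triangle_coe_image]
  refine Convex.isPreconnected (((convex_stdSimplex ℝ _).inter hQ).inter ?_)
  have : {x : Fin 3 → ℝ | ∀ i, M.IsMissingCorner i → x i < 1} =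
      ⋂ i, ⋂ _ : M.IsMissingCorner i, {x | x i < 1} := by
    ext; simp
  rw [this]
  exact convex_iInter₂ fun i _ => convex_halfSpace_lt (LinearMap.proj i).isLinear 1

lemma isCompact_truncated_triangle {c : ℝ} (hc : c < 1) :
    IsCompact {t : M.Triangle | ∀ i, M.IsMissingCorner i → t.1.1 i ≤ c} := by
  have hset : {t : M.Triangle | ∀ i, M.IsMissingCorner i → t.1.1 i ≤ c} =
      {t | t.1.1 ∈ {x : Fin 3 → ℝ | ∀ i, M.IsMissingCorner i → x i ≤ c}} := rfl
  rw [isEmbedding_triangle_coe.isInducing.isCompact_iff, hset, triangle_coe_image,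
    Set.inter_eq_left.2 fun x hx i hi => (hx.2 i hi).trans_lt hc]
  refine (isCompact_stdSimplex ℝ (Fin 3)).inter_right ?_
  have : {x : Fin 3 → ℝ | ∀ i, M.IsMissingCorner i → x i ≤ c} =
      ⋂ i, ⋂ _ : M.IsMissingCorner i, {x | x i ≤ c} := by
    ext; simp
  rw [this]
  exact isClosed_iInter fun i => isClosed_iInter fun _ =>
    isClosed_le (continuous_apply i) continuous_const

/-- An interior point of side `j` of the triangle. -/
lemma exists_mem_side {i j : Fin 3} (hij : i ≠ j) {s : ℝ} (h0 : 0 < s) (h1 : s < 1) :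
    ∃ t : M.Triangle, t.1.1 j = 0 ∧ t.1.1 i = s := by
  let f : Fin 3 → ℝ := fun l => if l = j then 0 else if l = i then s else 1 - s
  have hf : f ∈ stdSimplex ℝ (Fin 3) := by
    refine ⟨fun l => ?_, ?_⟩
    · dsimp only [f]; split_ifs <;> linarith
    · rw [Fin.sum_univ_three]
      fin_cases i <;> fin_cases j <;> simp [f] at hij ⊢
  refine ⟨⟨⟨f, hf⟩, fun l hl => absurd hl ?_⟩, ?_, ?_⟩
  · show f l ≠ 1
    dsimp only [f]
    split_ifs <;> linarith
  · show f j = 0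
    simp [f]
  · show f i = s
    simp [f, hij]

/-- The point of the cover with given coordinates in the triangle of `g`. -/
def coverPoint (g : M.Mon) (t : M.Triangle) : M.CoverSurface := Quot.mk _ ⟨g, t⟩

lemma coverPoint_mul (g : M.Mon) {t : M.Triangle} {i : Fin 3} (h : t.1.1 i = 0) :
    coverPoint (g * M.ρ i) t = coverPoint g t :=
  (Quot.sound ⟨i, h, rfl, rfl⟩).symm

lemma continuous_coverPoint (g : M.Mon) : Continuous (coverPoint g) :=
  continuous_quot_mk.comp (continuous_sigmaMk (σ := fun _ : M.Mon => M.Triangle))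

lemma exists_coverPoint (x : M.CoverSurface) : ∃ g t, x = coverPoint g t := by
  obtain ⟨⟨g, t⟩, rfl⟩ := Quot.exists_rep x
  exact ⟨g, t, rfl⟩

/-- The barycentric coordinates on the cover. -/
def coverCoord (i : Fin 3) : M.CoverSurface → ℝ :=
  Quot.lift (fun p => p.2.1.1 i) (by
    rintro p q ⟨j, -, -, h⟩
    exact congrArg (fun t : M.Triangle => t.1.1 i) h.symm)

lemma continuous_coverCoord (i : Fin 3) : Continuous (coverCoord (M := M) i) :=
  continuous_quot_lift _ (continuous_sigma fun _ =>
    (continuous_apply i).comp isEmbedding_triangle_coe.continuous)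

/-- `F` lists the triangles around the point `t`, relative to one of them. At a corner these are the
rotations and their products with one reflection, finitely many because only corners with a rotation
of finite order are kept. -/
lemma exists_finite_mul_mem (hinv : ∀ i, M.ρ i * M.ρ i = 1) (t : M.Triangle) :
    ∃ F : Set M.Mon, F.Finite ∧ 1 ∈ F ∧ ∀ f ∈ F, ∀ i, t.1.1 i = 0 → f * M.ρ i ∈ F := by
  have hsum : t.1.1 0 + t.1.1 1 + t.1.1 2 = 1 := by rw [← Fin.sum_univ_three]; exact t.1.2.2
  by_cases hone : ∃ i j, i ≠ j ∧ t.1.1 i = 0 ∧ t.1.1 j = 0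
  · obtain ⟨i, j, hij, hi, hj⟩ := hone
    obtain ⟨k, hki, hkj, hk⟩ : ∃ k, i ≠ k ∧ j ≠ k ∧ t.1.1 k = 1 := by
      fin_cases i <;> fin_cases j <;> simp at hij hi hj
      · exact ⟨2, by decide, by decide, by simpa [hi, hj] using hsum⟩
      · exact ⟨1, by decide, by decide, by simpa [hi, hj] using hsum⟩
      · exact ⟨2, by decide, by decide, by simpa [hi, hj] using hsum⟩
      · exact ⟨0, by decide, by decide, by simpa [hi, hj] using hsum⟩
      · exact ⟨1, by decide, by decide, by simpa [hi, hj] using hsum⟩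
      · exact ⟨0, by decide, by decide, by simpa [hi, hj] using hsum⟩
    have hfin : (Subgroup.zpowers (M.ρ i * M.ρ j) : Set M.Mon).Finite :=
      finite_zpowers.2 (t.2 k hk i j hki hkj)
    refine ⟨(Subgroup.zpowers (M.ρ i * M.ρ j) : Set M.Mon) ∪
      (· * M.ρ i) '' (Subgroup.zpowers (M.ρ i * M.ρ j) : Set M.Mon), hfin.union (hfin.image _),
      Or.inl (one_mem _), ?_⟩
    intro f hf l hl
    have hlij : l = i ∨ l = j := by
      by_contra hcon
      rw [not_or] at hcon
      have : l = k := by omega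
      rw [this, hk] at hl
      exact one_ne_zero hl
    have hz := Subgroup.mem_zpowers (M.ρ i * M.ρ j)
    rcases hlij with rfl | rfl <;> rcases hf with hf | ⟨f, hf, rfl⟩
    · exact Or.inr ⟨f, hf, rfl⟩
    · left
      show f * M.ρ l * M.ρ l ∈ _
      rwa [mul_assoc, hinv, mul_one]
    · right
      refine ⟨f * (M.ρ i * M.ρ l)⁻¹, Subgroup.mul_mem _ hf (Subgroup.inv_mem _ hz), ?_⟩
      have h1 : (M.ρ i)⁻¹ = M.ρ i := inv_eq_of_mul_eq_one_left (hinv i)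
      have h2 : (M.ρ l)⁻¹ = M.ρ l := inv_eq_of_mul_eq_one_left (hinv l)
      simp [mul_assoc, h1, h2, hinv]
    · left
      show f * M.ρ i * M.ρ l ∈ _
      rw [mul_assoc]
      exact Subgroup.mul_mem _ hf hz
  · by_cases hz : ∃ i, t.1.1 i = 0
    · obtain ⟨i, hi⟩ := hz
      refine ⟨{1, M.ρ i}, Set.toFinite _, by simp, fun f hf l hl => ?_⟩
      have : l = i := by
        by_contra hli
        exact hone ⟨l, i, hli, hl, hi⟩
      subst this
      rcases hf with rfl | rfl
      · simp
      · simp [hinv]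
    · exact ⟨{1}, Set.finite_singleton _, rfl, fun f _ l hl => absurd ⟨l, hl⟩ hz⟩

lemma locallyFinite_range_coverPoint (hinv : ∀ i, M.ρ i * M.ρ i = 1) :
    LocallyFinite fun g : M.Mon => Set.range (coverPoint g) := by
  intro x
  obtain ⟨g, t, rfl⟩ := exists_coverPoint x
  obtain ⟨F, hF, h1, hmul⟩ := exists_finite_mul_mem hinv t
  -- The open star of the point: the triangles `g * f` with `f ∈ F`, restricted to positive
  -- coordinates where `t` has nonzero ones. Gluing respects it, since only sides through `t` are
  -- crossed.
  let U : Set M.CoverSurface := {y | Quot.lift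
    (fun p : (_ : M.Mon) × M.Triangle => g⁻¹ * p.1 ∈ F ∧ ∀ i, t.1.1 i ≠ 0 → 0 < p.2.1.1 i) (by
      rintro ⟨a, u⟩ ⟨b, w⟩ ⟨i, hi, hb, hw⟩
      dsimp only at hi hb hw
      subst hb hw
      refine propext (and_congr_left fun hpos => ?_)
      have hti : t.1.1 i = 0 := by
        by_contra hne
        exact absurd hi (hpos i hne).ne'
      refine ⟨fun h => ?_, fun h => ?_⟩
      · rw [← mul_assoc]
        exact hmul _ h i hti
      · have := hmul _ h i hti
        rwa [mul_assoc, mul_assoc, hinv, mul_one] at this) y}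
  have hU : IsOpen U := by
    refine (isQuotientMap_quot_mk (r := M.Glue)).isOpen_preimage.1 (isOpen_sigma_iff.2 fun a => ?_)
    by_cases ha : g⁻¹ * a ∈ F
    · have : Sigma.mk a ⁻¹' (Quot.mk M.Glue ⁻¹' U) =
          ⋂ i, ⋂ _ : t.1.1 i ≠ 0, {u : M.Triangle | 0 < u.1.1 i} := by
        ext u
        simp only [Set.mem_iInter]
        exact ⟨fun h => h.2, fun h => ⟨ha, h⟩⟩
      rw [this]
      exact isOpen_iInter_of_finite fun i => isOpen_iInter_of_finite fun _ =>
        isOpen_lt continuous_const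
          ((continuous_apply i).comp isEmbedding_triangle_coe.continuous)
    · have : Sigma.mk a ⁻¹' (Quot.mk M.Glue ⁻¹' U) = ∅ := by
        ext u
        exact ⟨fun h => ha h.1, fun h => h.elim⟩
      rw [this]
      exact isOpen_empty
  refine ⟨U, hU.mem_nhds ⟨by simpa using h1, fun i hi => lt_of_le_of_ne (t.1.2.1 i) hi.symm⟩,
    (hF.image (g * ·)).subset ?_⟩
  rintro a ⟨_, ⟨u, rfl⟩, hu⟩
  exact ⟨g⁻¹ * a, hu.1, by simp⟩

lemma isPreconnected_range_coverPoint (g : M.Mon) : IsPreconnected (Set.range (coverPoint g)) := by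
  have h := (isPreconnected_triangle (M := M) convex_univ).image _
    (continuous_coverPoint g).continuousOn
  convert h
  ext
  simp

/-- The part of the triangle of `g` close to the corner `i`. -/
def coverCorner (i : Fin 3) (c : ℝ) (g : M.Mon) : Set M.CoverSurface :=
  coverPoint g '' {t | c < t.1.1 i}

lemma isPreconnected_coverCorner (i : Fin 3) (c : ℝ) (g : M.Mon) :
    IsPreconnected (coverCorner i c g) :=
  (isPreconnected_triangle (Q := {x | c < x i})
    (convex_halfSpace_gt (LinearMap.proj (R := ℝ) (φ := fun _ : Fin 3 => ℝ) i).isLinear c)).image _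
    (continuous_coverPoint g).continuousOn

/-- At a missing corner the coordinate is continuous and never equals `1`, so its maximum on `K` is
smaller. Positivity of `c` is arranged for `exists_mem_side`. -/
lemma exists_forall_coverCoord_le {K : Set M.CoverSurface} (hK : IsCompact K) :
    ∃ c, 0 < c ∧ c < 1 ∧ ∀ i, M.IsMissingCorner i → ∀ x ∈ K, coverCoord i x ≤ c := by
  have h : ∀ i, ∃ c, 0 < c ∧ c < 1 ∧ (M.IsMissingCorner i → ∀ x ∈ K, coverCoord i x ≤ c) := by
    intro i
    by_cases hi : M.IsMissingCorner i
    · rcases K.eq_empty_or_nonempty with rfl | hne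
      · exact ⟨1 / 2, by norm_num, by norm_num, by simp⟩
      · obtain ⟨y, hy, hmax⟩ := hK.exists_isMaxOn hne (continuous_coverCoord i).continuousOn
        have hy1 : coverCoord i y < 1 := by
          obtain ⟨g, t, rfl⟩ := exists_coverPoint y
          exact t.lt_one hi
        exact ⟨max (1 / 2) (coverCoord i y), by positivity, max_lt (by norm_num) hy1,
          fun _ x hx => (hmax hx).trans (le_max_right _ _)⟩
    · exact ⟨1 / 2, by norm_num, by norm_num, fun h => absurd h hi⟩
  choose c h0 h1 h2 using h
  obtain ⟨j, hj⟩ := Finite.exists_max c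
  exact ⟨c j, h0 j, h1 j, fun i hi x hx => (h2 i hi x hx).trans (hj i)⟩

/-- `L` consists of the finitely many triangles of `A'`, truncated at missing corners. A point
outside `L` lies in a distant triangle or near a missing corner; turning about the corner by powers
of the infinite-order `ρ j * ρ k` leaves the finite set `A'`. -/
theorem exists_isCompact_compl_subset (hinv : ∀ i, M.ρ i * M.ρ i = 1) [Infinite M.Mon]
    (hcay : ∀ A : Set M.Mon, A.Finite → ∃ A' : Set M.Mon, A'.Finite ∧
      ∃ p, ∀ g ∉ A', CayleyRel M.ρ A g p)
    {K : Set M.CoverSurface} (hK : IsCompact K) :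
    ∃ L, IsCompact L ∧ ∃ x ∈ Kᶜ, Lᶜ ⊆ connectedComponentIn Kᶜ x := by
  let A : Set M.Mon := {g | (Set.range (coverPoint g) ∩ K).Nonempty}
  have hA : A.Finite := (locallyFinite_range_coverPoint hinv).finite_nonempty_inter_compact hK
  obtain ⟨A₁, hA₁, p, hp⟩ := hcay A hA
  let A' := A ∪ A₁
  have hA' : A'.Finite := hA.union hA₁
  obtain ⟨c, hc0, hc1, hc⟩ := exists_forall_coverCoord_le hK
  obtain ⟨b, -, -⟩ := exists_mem_side (M := M) (i := 0) (j := 1) (by decide) hc0 hc1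
  have hcell : ∀ g ∉ A, Set.range (coverPoint g) ⊆ Kᶜ := fun g hg x hx hxK => hg ⟨x, hx, hxK⟩
  have hsub : ∀ g ∉ A, ∀ x ∈ Set.range (coverPoint g),
      Set.range (coverPoint g) ⊆ connectedComponentIn Kᶜ x := fun g hg x hx =>
    (isPreconnected_range_coverPoint g).subset_connectedComponentIn hx (hcell g hg)
  have hrel : ∀ g h, CayleyRel M.ρ A g h →
      connectedComponentIn Kᶜ (coverPoint g b) = connectedComponentIn Kᶜ (coverPoint h b) := by
    intro g h hgh
    induction hgh with
    | refl => rfl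
    | @tail g' _ _ hs ih =>
      obtain ⟨h1, h2, i, rfl⟩ := hs
      rw [ih]
      -- Neighbouring triangles that miss `K` share a point `t` of side `i`, hence lie in one
      -- component.
      obtain ⟨j, hj⟩ := exists_ne i
      obtain ⟨t, ht, -⟩ := exists_mem_side (M := M) hj hc0 hc1
      rw [connectedComponentIn_eq (hsub g' h1 _ ⟨b, rfl⟩ ⟨t, rfl⟩),
        connectedComponentIn_eq (hsub _ h2 _ ⟨b, rfl⟩ ⟨t, rfl⟩), coverPoint_mul g' ht]
  obtain ⟨g₀, hg₀⟩ := hA'.infinite_compl.nonempty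
  have hfar : ∀ g ∉ A', Set.range (coverPoint g) ⊆
      connectedComponentIn Kᶜ (coverPoint g₀ b) := by
    intro g hg
    rw [hrel g₀ p (hp g₀ fun h => hg₀ (Or.inr h)), ← hrel g p (hp g fun h => hg (Or.inr h))]
    exact hsub g (fun h => hg (Or.inl h)) _ ⟨b, rfl⟩
  refine ⟨⋃ g ∈ A', coverPoint g '' {t | ∀ i, M.IsMissingCorner i → t.1.1 i ≤ c},
    hA'.isCompact_biUnion fun g _ =>
      (isCompact_truncated_triangle hc1).image (continuous_coverPoint g),
    coverPoint g₀ b, hcell g₀ (fun h => hg₀ (Or.inl h)) ⟨b, rfl⟩, ?_⟩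
  intro x hx
  obtain ⟨g, t, rfl⟩ := exists_coverPoint x
  by_cases hg : g ∈ A'
  swap
  · exact hfar g hg ⟨t, rfl⟩
  obtain ⟨i, hi, hti⟩ : ∃ i, M.IsMissingCorner i ∧ c < t.1.1 i := by
    by_contra hcon
    push Not at hcon
    exact hx (Set.mem_biUnion hg ⟨t, hcon, rfl⟩)
  have hcorner : ∀ h, coverCorner i c h ⊆ Kᶜ := by
    rintro h _ ⟨u, hu, rfl⟩ huK
    exact absurd (hc i hi _ huK) (not_le.2 hu)
  -- walk around the missing corner
  have hturn : ∀ h, ∀ j ≠ i, coverCorner i c h ⊆ connectedComponentIn Kᶜ (coverPoint g t) →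
      coverCorner i c (h * M.ρ j) ⊆ connectedComponentIn Kᶜ (coverPoint g t) := by
    intro h j hj hh
    -- The value `(1 + c) / 2` lies between `c` and `1`: `u` is on the common side `j` and within
    -- both corner pieces.
    obtain ⟨u, hu0, hu⟩ := exists_mem_side (M := M) hj.symm (s := (1 + c) / 2)
      (by linarith) (by linarith)
    have hcu : c < u.1.1 i := by rw [hu]; linarith
    rw [connectedComponentIn_eq (hh ⟨u, hcu, rfl⟩)]
    exact (isPreconnected_coverCorner i c _).subset_connectedComponentIn
      ⟨u, hcu, coverPoint_mul h hu0⟩ (hcorner _)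
  obtain ⟨j, k, hj, hk, hjk⟩ := hi
  have hpow : ∀ n : ℕ, coverCorner i c (g * (M.ρ j * M.ρ k) ^ n) ⊆
      connectedComponentIn Kᶜ (coverPoint g t) := by
    intro n
    induction n with
    | zero =>
      rw [pow_zero, mul_one]
      exact (isPreconnected_coverCorner i c g).subset_connectedComponentIn ⟨t, hti, rfl⟩
        (hcorner g)
    | succ n ih =>
      rw [pow_succ, ← mul_assoc, ← mul_assoc]
      exact hturn _ k hk (hturn _ j hj ih)
  obtain ⟨n, hn⟩ : ∃ n : ℕ, g * (M.ρ j * M.ρ k) ^ n ∉ A' := by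
    by_contra hcon
    push Not at hcon
    have hinj : Function.Injective fun n : ℕ => g * (M.ρ j * M.ρ k) ^ n :=
      (mul_right_injective g).comp (injective_pow_iff_not_isOfFinOrder.2 hjk)
    exact Set.infinite_of_injective_forall_mem hinj hcon hA'
  have h1 := hpow n ⟨t, hti, rfl⟩
  have h2 := hfar _ hn ⟨t, rfl⟩
  rw [connectedComponentIn_eq h2, ← connectedComponentIn_eq h1]
  exact mem_connectedComponentIn (hcorner g ⟨t, hti, rfl⟩)

/-- A compact set meets only finitely many of the infinitely many triangles. -/
lemma compl_nonempty_of_isCompact (hinv : ∀ i, M.ρ i * M.ρ i = 1) [Infinite M.Mon]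
    {L : Set M.CoverSurface} (hL : IsCompact L) : Lᶜ.Nonempty := by
  have hA := (locallyFinite_range_coverPoint hinv).finite_nonempty_inter_compact hL
  obtain ⟨g, hg⟩ := hA.infinite_compl.nonempty
  obtain ⟨t, -⟩ := exists_mem_side (M := M) (i := 0) (j := 1) (by decide)
    (s := 1 / 2) (by norm_num) (by norm_num)
  exact ⟨coverPoint g t, fun h => hg ⟨_, ⟨t, rfl⟩, h⟩⟩

end SurfaceMap

theorem mainTheorem4 {S : Type*} [TopologicalSpace S] [T2Space S] [ConnectedSpace S]
    [ChartedSpace (EuclideanSpace ℝ (Fin 2)) S] (M : SurfaceMap S)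
    (n : ℕ) (hn : 2 ≤ n)
    (hAut : ∃ H : Subgroup M.Aut, H.FiniteIndex ∧
      Nonempty (H ≃* Multiplicative (Fin n → ℤ)))
    (hOrb : Finite (MulAction.orbitRel.Quotient M.Aut M.Flag)) :
    ∃ E : TopEnd M.CoverSurface, ∀ E' : TopEnd M.CoverSurface, E' = E := by
  obtain ⟨N, hN, m, hm, ⟨e⟩⟩ := SurfaceMap.exists_finiteIndex_Mon hn hAut hOrb
  have hinf : Infinite M.Mon := infinite_of_finiteIndex_mulEquiv N hm e
  refine TopEnd.exists_unique_of_forall_compacts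
    (fun L => SurfaceMap.compl_nonempty_of_isCompact SurfaceMap.ρ_mul_self L.isCompact)
    fun K => ?_
  obtain ⟨L, hL, x, hx, h⟩ := SurfaceMap.exists_isCompact_compl_subset SurfaceMap.ρ_mul_self
    (fun A hA => exists_finite_forall_cayleyRel SurfaceMap.ρ_mul_self SurfaceMap.closure_range_ρ
      N hm e hA) K.isCompact
  exact ⟨⟨L, hL⟩, x, hx, h⟩
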